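/- An instance consists of $n\ge 1$ teams $T=\{1,\dots,n\}$ and $m\ge 0$ players $P=\{p_1,\dots,p_m\}$, a real number $v_i(p)$ (positive, negative or zero) for each $i\in T$, $p\in P$, and a complete transitive preference relation $\succsim_p$ over $T$ for each $p\in P$. For $S\subseteq P$ let $v_i(S)=\sum_{p\in S}v_i(p)$. The rank of team $i$ for player $p$ is $1+|\{j\in T: j\succ_p i\}|$. An allocation $A=(A_1,\dots,A_n)$ is an ordered partition of $P$ into $n$ possibly empty parts. It is - balanced if $\bigl||A_i|-|A_j|\bigr|\le 1$ for all $i,j\in T$; - EF1 (resp. EF[1,1]) if for all distinct $i,j\in T$ there are $X\subseteq A_i$ and $Y\subseteq A_j$ with $|X\cup Y|\le 1$ (resp. $|X|\le 1$ and $|Y|\le 1$) such that $v_i(A_i\setminus X)\ge v_i(A_j\setminus Y)$; - swap stable if no exchange of two players $p\in A_i$ and $q\in A_j$ makes at least one of $p,q,i,j$ better off and none of them worse off, where a team $i$ is better off if the value under $v_i$ of its part increases, and a player $p$ is better off if it moves to a strictly $\succ_p$-preferred team. For $q\in Q=\{1,\dots,m\}$ let $f(q)\in T$ be the team with $f(q)\equiv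 q \pmod n$, and let $w(q,p)=v_{f(q)}(p)$ for $p\in P$. Algorithm 1 first takes a perfect matching $\mu$ between $Q$ and $P$ (position $q$ is matched to player $\mu_q$) for which the vector $(w(1,\mu_1),\dots,w(m,\mu_m))$ is lexicographically maximum; then, among all perfect matchings $\mu^*$ with $w(q,\mu^*_q)=w(q,\mu_q)$ for all $q\in Q$, it takes one that minimizes the sum over all players $p$ of the rank for $p$ of the team $f(q)$ of the position $q$ to which $p$ is matched; and it returns the allocation that assigns player $\mu^*_q$ to team $f(q)$ for every $q\in Q$. **Theorem 1.** For every instance, a balanced allocation that is EF[1,1] and swap stable exists, and so does a balanced allocation that is EF1 and swap stable if all values $v_i(p)$ are nonnegative or all are nonpositive. More precisely, for every instance Algorithm 1 has an output, and every output (for every way of breaking ties) is balanced, EF[1,1] and swap stable, and is moreover EF1 if all values $v_i(p)$ are nonnegative or all are nonpositive. Furthermore, Algorithm 1 can be implemented to run in polynomial time: there are a single program and a polynomial $B$ such that, on every instance with $n$ teams and $m$ players, the program halts after at most $B(n+m)$ steps with an output of Algorithm 1. Here programs run on a unit-cost random access machine over the natural numbers with addition, truncated subtraction and comparison of natural numbers,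 which starts with $n$ and $m$ in its memory and accesses the instance only through unit-cost tests of the form $v_i(p)\le v_i(q)$ and $i\succsim_p j$. -/

import Mathlib

namespace TwoSidedDivision

/-- An instance with team set `Fin n` and player set `Fin m`.  `value i p` is the value of player `p`
for team `i`, an arbitrary real number; `pref p i j` says that player `p` finds team `i` at least as
good as team `j`, and it is a complete transitive relation. -/
structure FairInstance (n m : ℕ) where
  value : Fin n → Fin m → ℝ
  pref : Fin m → Fin n → Fin n → Prop
  pref_total : ∀ p i j, pref p i j ∨ pref p j i
  pref_trans : ∀ p i j k, pref p i j → pref p j k → pref p i k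

/-- An allocation (an ordered partition of the players into `n` possibly empty parts), given by the
team of each player. -/
abbrev Allocation (n m : ℕ) : Type := Fin m → Fin n

/-- The part of the partition that is assigned to team `i`. -/
def Allocation.bundle {n m : ℕ} (A : Allocation n m) (i : Fin n) : Finset (Fin m) :=
  Finset.univ.filter fun p => A p = i

namespace FairInstance

variable {n m : ℕ} (I : FairInstance n m)

/-- The additive valuation of team `i`. -/
def setValue (i : Fin n) (S : Finset (Fin m)) : ℝ := ∑ p ∈ S, I.value i p

/-- Player `p` strictly prefers team `i` to team `j`. -/
def StrictPref (p : Fin m) (i j : Fin n) : Prop := I.pref p i j ∧ ¬ I.pref p j i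

open Classical in
/-- One plus the number of teams that `p` strictly prefers to `i`. -/
noncomputable def rank (p : Fin m) (i : Fin n) : ℕ :=
  1 + (Finset.univ.filter fun j => I.StrictPref p j i).card

def NonnegativeValue : Prop := ∀ i p, 0 ≤ I.value i p

def NonpositiveValue : Prop := ∀ i p, I.value i p ≤ 0

/-- Envy-freeness up to one player. -/
def EF1 (A : Allocation n m) : Prop :=
  ∀ i j : Fin n, i ≠ j → ∃ X Y : Finset (Fin m),
    X ⊆ A.bundle i ∧ Y ⊆ A.bundle j ∧ (X ∪ Y).card ≤ 1 ∧
      I.setValue i (A.bundle j \ Y) ≤ I.setValue i (A.bundle i \ X)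

/-- The relaxation EF[1,1]. -/
def EF11 (A : Allocation n m) : Prop :=
  ∀ i j : Fin n, i ≠ j → ∃ X Y : Finset (Fin m),
    X ⊆ A.bundle i ∧ Y ⊆ A.bundle j ∧ X.card ≤ 1 ∧ Y.card ≤ 1 ∧
      I.setValue i (A.bundle j \ Y) ≤ I.setValue i (A.bundle i \ X)

def TeamBetterOff (A A' : Allocation n m) (i : Fin n) : Prop :=
  I.setValue i (A.bundle i) < I.setValue i (A'.bundle i)

def PlayerBetterOff (A A' : Allocation n m) (p : Fin m) : Prop :=
  I.StrictPref p (A' p) (A p)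

/-- Exchanging the players `p` and `q` makes at least one of the four involved parties (the two
players and their teams) better off and none of them worse off. -/
def BeneficialSwap (A : Allocation n m) (p q : Fin m) : Prop :=
  let A' : Allocation n m := fun x => A (Equiv.swap p q x)
  (¬ I.TeamBetterOff A' A (A p) ∧ ¬ I.TeamBetterOff A' A (A q) ∧
    ¬ I.PlayerBetterOff A' A p ∧ ¬ I.PlayerBetterOff A' A q) ∧
  (I.TeamBetterOff A A' (A p) ∨ I.TeamBetterOff A A' (A q) ∨
    I.PlayerBetterOff A A' p ∨ I.PlayerBetterOff A A' q)

def SwapStable (A : Allocation n m) : Prop := ∀ p q, ¬ I.BeneficialSwap A p q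

end FairInstance

/-- The sizes of any two parts differ by at most one. -/
def Allocation.Balanced {n m : ℕ} (A : Allocation n m) : Prop :=
  ∀ i j : Fin n, |((A.bundle i).card : ℤ) - ((A.bundle j).card : ℤ)| ≤ 1

section Algorithm

variable {n m : ℕ} [NeZero n] (I : FairInstance n m)

/-- The team to which a round-robin position belongs.  Positions and teams are both numbered from
`0`, so this is the residue modulo `n`. -/
def positionTeam (q : Fin m) : Fin n := Fin.ofNat n q

/-- The weight of the edge between position `q` and player `p`. -/
def FairInstance.weight (q p : Fin m) : ℝ := I.value (positionTeam q) p

/-- Perfect matchings between positions and players are bijections `Fin m ≃ Fin m`, mapping each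
position to its player.  The matching `μ` is lexicographically maximum: for each position in turn,
its weight is as large as possible subject to the weights of the earlier positions. -/
def IsLexMaxMatching (μ : Fin m ≃ Fin m) : Prop :=
  ∀ (q : Fin m) (ν : Fin m ≃ Fin m), (∀ r < q, I.weight r (ν r) = I.weight r (μ r)) →
    I.weight q (ν q) ≤ I.weight q (μ q)

/-- Every edge of `ν` has the same weight as the edge of `μ` at the same position. -/
def KeepsWeights (μ ν : Fin m ≃ Fin m) : Prop := ∀ q, I.weight q (ν q) = I.weight q (μ q)

/-- The sum over all players of the rank of the team of their position. -/
noncomputable def rankSum (ν : Fin m ≃ Fin m) : ℕ := ∑ p, I.rank p (positionTeam (ν.symm p))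

/-- `μ'` is a perfect matching of minimum rank sum among those whose edges keep the weights
of `μ`. -/
def IsRankMinMatching (μ μ' : Fin m ≃ Fin m) : Prop :=
  KeepsWeights I μ μ' ∧ ∀ ν, KeepsWeights I μ ν → rankSum I μ' ≤ rankSum I ν

/-- `A` is a possible output of the two-phase matching algorithm (for some way of breaking ties in
its two matching steps). -/
def IsAlgorithmOutput (A : Allocation n m) : Prop :=
  ∃ μ μ' : Fin m ≃ Fin m, IsLexMaxMatching I μ ∧ IsRankMinMatching I μ μ' ∧
    ∀ p, A p = positionTeam (μ'.symm p)

end Algorithm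

/-! ### The machine model

A random access machine with finitely many named scalar variables and arrays of natural numbers
in each program, at unit cost, with addition and truncated subtraction as the only
arithmetic operations (so the length of the numbers stays linear in the number of steps). The real
values of an instance can only be compared with each other, one pair at a time. -/

/-- The memory: scalar variables, and for each array name the contents of its cells. -/
structure Memory where
  var : ℕ → ℕ
  arr : ℕ → ℕ → ℕ

def Memory.setVar (s : Memory) (x k : ℕ) : Memory where
  var := Function.update s.var x k
  arr := s.arr

def Memory.setArr (s : Memory) (a j k : ℕ) : Memory where
  var := s.var
  arr := Function.update s.arr a (Function.update (s.arr a) j k)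

/-- Expressions; `get a e` reads the cell of array `a` whose index is the value of `e`. -/
inductive NExp where
  | lit (k : ℕ)
  | var (x : ℕ)
  | get (a : ℕ) (e : NExp)
  | add (e₁ e₂ : NExp)
  | sub (e₁ e₂ : NExp)

def NExp.eval (s : Memory) : NExp → ℕ
  | .lit k => k
  | .var x => s.var x
  | .get a e => s.arr a (e.eval s)
  | .add e₁ e₂ => e₁.eval s + e₂.eval s
  | .sub e₁ e₂ => e₁.eval s - e₂.eval s

def NExp.cost : NExp → ℕ
  | .lit _ => 1
  | .var _ => 1
  | .get _ e => e.cost + 1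
  | .add e₁ e₂ => e₁.cost + e₂.cost + 1
  | .sub e₁ e₂ => e₁.cost + e₂.cost + 1

/-- Tests.  Besides comparing numbers, a test can ask whether a team `i` values player `p` at most
as much as player `q`, and whether player `p` finds team `i` at least as good as team `j`. -/
inductive BExp where
  | le (e₁ e₂ : NExp)
  | valueLE (i p q : NExp)
  | pref (p i j : NExp)
  | not (b : BExp)
  | and (b₁ b₂ : BExp)

/-- Queries with an index out of range are false. -/
def BExp.eval {n m : ℕ} (I : FairInstance n m) (s : Memory) : BExp → Prop
  | .le e₁ e₂ => e₁.eval s ≤ e₂.eval s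
  | .valueLE i p q => ∃ (hi : i.eval s < n) (hp : p.eval s < m) (hq : q.eval s < m),
      I.value ⟨i.eval s, hi⟩ ⟨p.eval s, hp⟩ ≤ I.value ⟨i.eval s, hi⟩ ⟨q.eval s, hq⟩
  | .pref p i j => ∃ (hp : p.eval s < m) (hi : i.eval s < n) (hj : j.eval s < n),
      I.pref ⟨p.eval s, hp⟩ ⟨i.eval s, hi⟩ ⟨j.eval s, hj⟩
  | .not b => ¬ b.eval I s
  | .and b₁ b₂ => b₁.eval I s ∧ b₂.eval I s

def BExp.cost : BExp → ℕ
  | .le e₁ e₂ => e₁.cost + e₂.cost + 1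
  | .valueLE i p q => i.cost + p.cost + q.cost + 1
  | .pref p i j => p.cost + i.cost + j.cost + 1
  | .not b => b.cost + 1
  | .and b₁ b₂ => b₁.cost + b₂.cost + 1

/-- Programs. -/
inductive Cmd where
  | skip
  | assign (x : ℕ) (e : NExp)
  | store (a : ℕ) (e₁ e₂ : NExp)
  | seq (c₁ c₂ : Cmd)
  | ite (b : BExp) (c₁ c₂ : Cmd)
  | loop (b : BExp) (c : Cmd)

/-- `Exec I c s s' t`: on the instance `I`, the program `c` started in memory `s` halts in memory
`s'` after exactly `t` steps.  `loop b c` repeats `c` while `b` holds. -/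
inductive Exec {n m : ℕ} (I : FairInstance n m) : Cmd → Memory → Memory → ℕ → Prop where
  | skip (s : Memory) : Exec I .skip s s 1
  | assign (x : ℕ) (e : NExp) (s : Memory) :
      Exec I (.assign x e) s (s.setVar x (e.eval s)) (e.cost + 1)
  | store (a : ℕ) (e₁ e₂ : NExp) (s : Memory) :
      Exec I (.store a e₁ e₂) s (s.setArr a (e₁.eval s) (e₂.eval s))
        (e₁.cost + e₂.cost + 1)
  | seq {c₁ c₂ : Cmd} {s s' s'' : Memory} {t₁ t₂ : ℕ} :
      Exec I c₁ s s' t₁ → Exec I c₂ s' s'' t₂ → Exec I (.seq c₁ c₂) s s'' (t₁ + t₂)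
  | ite_true {b : BExp} {c₁ c₂ : Cmd} {s s' : Memory} {t : ℕ} :
      b.eval I s → Exec I c₁ s s' t → Exec I (.ite b c₁ c₂) s s' (b.cost + 1 + t)
  | ite_false {b : BExp} {c₁ c₂ : Cmd} {s s' : Memory} {t : ℕ} :
      ¬ b.eval I s → Exec I c₂ s s' t → Exec I (.ite b c₁ c₂) s s' (b.cost + 1 + t)
  | loop_done {b : BExp} {c : Cmd} {s : Memory} :
      ¬ b.eval I s → Exec I (.loop b c) s s (b.cost + 1)
  | loop_step {b : BExp} {c : Cmd} {s s' s'' : Memory} {t₁ t₂ : ℕ} :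
      b.eval I s → Exec I c s s' t₁ → Exec I (.loop b c) s' s'' t₂ →
      Exec I (.loop b c) s s'' (b.cost + 1 + t₁ + t₂)

/-- The machine is deterministic, so the final memory and the running time are well defined. -/
theorem Exec.deterministic {n m : ℕ} {I : FairInstance n m} {c : Cmd} {s s₁ : Memory} {t₁ : ℕ}
    (h₁ : Exec I c s s₁ t₁) : ∀ {s₂ : Memory} {t₂ : ℕ}, Exec I c s s₂ t₂ → s₁ = s₂ ∧ t₁ = t₂ := by
  induction h₁ with
  | skip s => intro _ _ h; cases h; exact ⟨rfl, rfl⟩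
  | assign x e s => intro _ _ h; cases h; exact ⟨rfl, rfl⟩
  | store a e₁ e₂ s => intro _ _ h; cases h; exact ⟨rfl, rfl⟩
  | seq _ _ ih₁ ih₂ =>
    intro _ _ h
    cases h with
    | seq g₁ g₂ =>
      obtain ⟨rfl, rfl⟩ := ih₁ g₁
      obtain ⟨rfl, rfl⟩ := ih₂ g₂
      exact ⟨rfl, rfl⟩
  | ite_true hb _ ih =>
    intro _ _ h
    cases h with
    | ite_true _ g => obtain ⟨rfl, rfl⟩ := ih g; exact ⟨rfl, rfl⟩
    | ite_false hb' _ => exact absurd hb hb'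
  | ite_false hb _ ih =>
    intro _ _ h
    cases h with
    | ite_true hb' _ => exact absurd hb' hb
    | ite_false _ g => obtain ⟨rfl, rfl⟩ := ih g; exact ⟨rfl, rfl⟩
  | loop_done hb =>
    intro _ _ h
    cases h with
    | loop_done _ => exact ⟨rfl, rfl⟩
    | loop_step hb' _ _ => exact absurd hb' hb
  | loop_step hb _ _ ih₁ ih₂ =>
    intro _ _ h
    cases h with
    | loop_done hb' => exact absurd hb hb'
    | loop_step _ g₁ g₂ =>
      obtain ⟨rfl, rfl⟩ := ih₁ g₁
      obtain ⟨rfl, rfl⟩ := ih₂ g₂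
      exact ⟨rfl, rfl⟩

/-- The initial memory: variable `0` holds the number of teams, variable `1` the number of players,
and everything else is zero. -/
def initialMemory (n m : ℕ) : Memory where
  var := fun x => if x = 0 then n else if x = 1 then m else 0
  arr := fun _ _ => 0

/-- On the instance `I`, the program `c` halts after exactly `t` steps, and then array `0` holds
the team of each player in the allocation `A`. -/
def Computes {n m : ℕ} (c : Cmd) (I : FairInstance n m) (A : Allocation n m) (t : ℕ) : Prop :=
  ∃ s : Memory, Exec I c (initialMemory n m) s t ∧ ∀ p : Fin m, s.arr 0 (p : ℕ) = (A p : ℕ)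

end TwoSidedDivision

open TwoSidedDivision

/-! If `μ` is lexicographically maximum, exchanging the players of positions `q ≤ r` cannot improve
position `q`, so no position envies a later one (`IsLexMaxMatching.weight_le`). Pairing each
position of team `j` with the last position of team `i` that is not after it leaves at most one
position of each team unpaired, namely the first of `j` and the last of `i`. This is EF[1,1]. When
all values have one sign, one of the two removals can be undone, which gives EF1. Balance is a count
of residues.

For swap stability, consider an exchange that harms nobody. The team of the earlier position does
not gain, by the absence of envy, so it is indifferent. The exchanged matching then ties with `μ`
before the later position, so lexicographic maximality denies the later team a gain too. Hence all
weights are kept, and minimality of the rank sum forbids a player to gain.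

For existence and running time, both phases are merged into one minimum-cost assignment problem. The
cost of an edge is the number of players that the team values more, scaled by a power of `m + 1`
that decreases with the position, plus the rank. Digits are at most `m`, so no later position
outweighs an earlier one, and the factor `n * m + 1` keeps the total of the ranks from interfering.
Such costs need only comparisons of values, and repeated addition builds them.

The Hungarian method solves this problem over the natural numbers. A matching of the first `k` rows
and columns is certified optimal by dual variables with `U q ≤ c q p + V p` and equality on matched
edges. To add row and column `k`, a tree of reached rows is grown from row `k`. Each reached row `r`
carries a whole matching `G r` in which `r` formally takes the new column `k` and every other edge
is tight, so augmenting amounts to copying `G r`. Raising the duals of the tree by the minimum slack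
makes a new edge tight. It either ends at column `k`, which augments, or adds a row to the tree,
which can happen fewer than `m` times. All loops count to `n` or `m`, so the time bound is read off
the syntax (`exec_toCmd`), and correctness is proved by loop invariants. -/

namespace TwoSidedDivision

/-! ### Ranks and exchanges of two players -/

section Instances

variable {n m : ℕ} {I : FairInstance n m} {A : Allocation n m}

theorem mem_bundle {i : Fin n} {p : Fin m} : p ∈ A.bundle i ↔ A p = i := by
  simp [Allocation.bundle]

theorem rank_le_of_pref {p : Fin m} {i j : Fin n} (h : I.pref p i j) : I.rank p i ≤ I.rank p j := by
  classical
  unfold FairInstance.rank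
  refine Nat.add_le_add_left (Finset.card_le_card fun k hk => ?_) 1
  simp only [Finset.mem_filter, Finset.mem_univ, true_and] at hk ⊢
  exact ⟨I.pref_trans p k i j hk.1 h, fun h' => hk.2 (I.pref_trans p i j k h h')⟩

theorem rank_lt_of_strictPref {p : Fin m} {i j : Fin n} (h : I.StrictPref p i j) :
    I.rank p i < I.rank p j := by
  classical
  unfold FairInstance.rank
  refine Nat.add_lt_add_left (Finset.card_lt_card ⟨fun k hk => ?_, fun hs => ?_⟩) 1
  · simp only [Finset.mem_filter, Finset.mem_univ, true_and] at hk ⊢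
    exact ⟨I.pref_trans p k i j hk.1 h.1, fun h' => hk.2 (I.pref_trans p i j k h.1 h')⟩
  · have : i ∈ Finset.univ.filter fun k => I.StrictPref p k i := hs (by simpa using h)
    simp only [Finset.mem_filter, Finset.mem_univ, true_and] at this
    exact this.2 this.1

theorem FairInstance.BeneficialSwap.symm {p q : Fin m} (h : I.BeneficialSwap A p q) :
    I.BeneficialSwap A q p := by
  unfold FairInstance.BeneficialSwap at h ⊢
  rw [Equiv.swap_comm q p]
  tauto

theorem FairInstance.setValue_swap_sub (I : FairInstance n m) (A : Allocation n m)
    {p q : Fin m}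
    (hpq : A p ≠ A q) :
    I.setValue (A p) (Allocation.bundle (fun x => A (Equiv.swap p q x)) (A p)) -
      I.setValue (A p) (A.bundle (A p)) = I.value (A p) q - I.value (A p) p := by
  have hne : q ≠ p := fun h => hpq (h ▸ rfl)
  have hb : Allocation.bundle (fun x => A (Equiv.swap p q x)) (A p) =
      insert q ((A.bundle (A p)).erase p) := by
    ext x
    simp only [mem_bundle, Finset.mem_insert, Finset.mem_erase]
    by_cases hx : x = p
    · subst hx
      simp [hpq.symm, hne.symm]
    by_cases hx' : x = q
    · subst hx'
      simp
    · simp [Equiv.swap_apply_of_ne_of_ne hx hx', hx, hx']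
  have hp : p ∈ A.bundle (A p) := mem_bundle.2 rfl
  have hq : q ∉ (A.bundle (A p)).erase p := by simp [mem_bundle, hpq.symm]
  unfold FairInstance.setValue
  rw [hb, Finset.sum_insert hq, ← Finset.add_sum_erase _ _ hp]
  ring

theorem rank_le (p : Fin m) (i : Fin n) : I.rank p i ≤ n := by
  classical
  have : (Finset.univ.filter fun j => I.StrictPref p j i).card < n := by
    refine (Finset.card_lt_univ_of_notMem (x := i) ?_).trans_eq (Fintype.card_fin n)
    simp only [Finset.mem_filter, Finset.mem_univ, true_and]
    exact fun h => h.2 h.1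
  unfold FairInstance.rank
  omega

end Instances

/-! ### Fairness and stability of the outputs -/

section Outputs

variable {n m : ℕ} [NeZero n] {I : FairInstance n m}

@[simp]
theorem positionTeam_val (q : Fin m) : ((positionTeam q : Fin n) : ℕ) = (q : ℕ) % n := rfl

theorem IsLexMaxMatching.of_keepsWeights {μ ν : Fin m ≃ Fin m} (h : IsLexMaxMatching I μ)
    (hν : KeepsWeights I μ ν) : IsLexMaxMatching I ν := by
  intro q ξ hξ
  rw [hν q]
  exact h q ξ fun r hr => (hξ r hr).trans (hν r)

/-- Keeping weights is transitive. The matching of the second phase can therefore replace that of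
the first, and the fairness and stability proofs deal with one matching only. -/
theorem IsRankMinMatching.self {μ ν : Fin m ≃ Fin m} (h : IsRankMinMatching I μ ν) :
    IsRankMinMatching I ν ν :=
  ⟨fun _ => rfl, fun ξ hξ => h.2 ξ fun q => (hξ q).trans (h.1 q)⟩

/-- In a lexicographically maximum matching no position envies a later one. -/
theorem IsLexMaxMatching.weight_le {μ : Fin m ≃ Fin m} (h : IsLexMaxMatching I μ) {q r : Fin m}
    (hqr : q ≤ r) : I.weight q (μ r) ≤ I.weight q (μ q) := by
  have := h q ((Equiv.swap q r).trans μ) fun s hs => by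
    simp [Equiv.swap_apply_of_ne_of_ne hs.ne (hs.trans_le hqr).ne]
  simpa using this

variable {μ : Fin m ≃ Fin m} {A : Allocation n m}

theorem balanced_of_matching (hA : ∀ p, A p = positionTeam (μ.symm p)) : A.Balanced := by
  -- `μ.symm` maps the bundle of `i` bijectively onto the positions below `m` that are congruent to
  -- `i` modulo `n`.
  have key : ∀ i : Fin n, (A.bundle i).card = m / n + if (i : ℕ) % n < m % n then 1 else 0 := by
    intro i
    have hn : 0 < n := Nat.pos_of_ne_zero (NeZero.ne n)
    rw [← Nat.count_modEq_card m hn i, Nat.count_eq_card_filter_range]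
    refine Finset.card_bij (fun p _ => (μ.symm p : ℕ)) ?_ ?_ ?_
    · intro p hp
      rw [mem_bundle, hA] at hp
      subst hp
      simp [Nat.ModEq]
    · intro p _ q _ h
      exact μ.symm.injective (Fin.ext h)
    · intro q hq
      simp only [Finset.mem_filter, Finset.mem_range] at hq
      refine ⟨μ ⟨q, hq.1⟩, ?_, by simp⟩
      rw [mem_bundle, hA]
      ext
      simpa [Nat.ModEq, Nat.mod_eq_of_lt i.2] using hq.2
  intro i j
  rw [key, key, abs_le]
  push_cast
  split_ifs <;> constructor <;> simp

/-- Positions of one team are congruent modulo `n`, so `n` consecutive positions contain at most one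
of them. -/
theorem card_le_one_of_window (hA : ∀ p, A p = positionTeam (μ.symm p)) {i : Fin n}
    {X : Finset (Fin m)} (hX : X ⊆ A.bundle i) (a : ℕ)
    (hw : ∀ p ∈ X, a ≤ (μ.symm p : ℕ) ∧ (μ.symm p : ℕ) < a + n) : X.card ≤ 1 := by
  rw [Finset.card_le_one]
  intro p hp q hq
  have h1 := mem_bundle.1 (hX hp)
  have h2 := mem_bundle.1 (hX hq)
  rw [hA] at h1 h2
  have h3 : (μ.symm p : ℕ) ≡ (μ.symm q : ℕ) [MOD n] := congrArg Fin.val (h1.trans h2.symm)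
  apply μ.symm.injective
  ext
  obtain ⟨a1, a2⟩ := hw p hp
  obtain ⟨b1, b2⟩ := hw q hq
  rcases le_total (μ.symm p : ℕ) (μ.symm q) with h | h
  · have := (Nat.modEq_iff_dvd' h).1 h3
    have := Nat.eq_zero_of_dvd_of_lt this (by omega)
    omega
  · have := (Nat.modEq_iff_dvd' h).1 h3.symm
    have := Nat.eq_zero_of_dvd_of_lt this (by omega)
    omega

/-- Comparing each position of team `j` with the last earlier position of team `i`. -/
theorem exists_exceptional_players (h : IsLexMaxMatching I μ)
    (hA : ∀ p, A p = positionTeam (μ.symm p)) {i j : Fin n} :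
    ∃ X Y : Finset (Fin m), X ⊆ A.bundle i ∧ Y ⊆ A.bundle j ∧ X.card ≤ 1 ∧ Y.card ≤ 1 ∧
      I.setValue i (A.bundle j \ Y) ≤ I.setValue i (A.bundle i \ X) := by
  have hn : 0 < n := Nat.pos_of_ne_zero (NeZero.ne n)
  -- Moving back by `d` places takes a position of `j` to the last position of `i` that is not after
  -- it.
  obtain ⟨d, hd, hdij⟩ : ∃ d < n, (i : ℕ) + d ≡ j [MOD n] := by
    refine ⟨(j + (n - i)) % n, Nat.mod_lt _ hn, ?_⟩
    have : (i : ℕ) + (j + (n - i)) = j + n := by omega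
    calc (i : ℕ) + (j + (n - i)) % n ≡ i + (j + (n - i)) [MOD n] :=
          Nat.ModEq.add_left _ (Nat.mod_modEq _ _)
      _ ≡ j [MOD n] := by rw [this]; simp [Nat.ModEq]
  have memb : ∀ p (i : Fin n), p ∈ A.bundle i ↔ (μ.symm p : ℕ) ≡ i [MOD n] := by
    intro p i
    rw [mem_bundle, hA, Fin.ext_iff, positionTeam_val, Nat.ModEq, Nat.mod_eq_of_lt i.2]
  -- The unpaired positions: those of `i` whose shift by `d` runs past the end, and those of `j`
  -- among the first `d`. Both sets lie in windows shorter than `n`.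
  refine ⟨(A.bundle i).filter fun p => m ≤ (μ.symm p : ℕ) + d,
    (A.bundle j).filter fun p => (μ.symm p : ℕ) < d, Finset.filter_subset _ _,
    Finset.filter_subset _ _, ?_, ?_, ?_⟩
  · refine card_le_one_of_window hA (Finset.filter_subset _ _) (m - d) fun p hp => ?_
    have := (Finset.mem_filter.1 hp).2
    have := (μ.symm p).2
    omega
  · refine card_le_one_of_window hA (Finset.filter_subset _ _) 0 fun p hp => ?_
    have := (Finset.mem_filter.1 hp).2
    omega
  · rw [← Finset.filter_not, ← Finset.filter_not]
    unfold FairInstance.setValue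
    simp only [not_lt, not_le]
    have hlt : ∀ p : Fin m, (μ.symm p : ℕ) - d < m := fun p => by
      have := (μ.symm p).2
      omega
    let φ : Fin m → Fin m := fun p => μ ⟨(μ.symm p : ℕ) - d, hlt p⟩
    have hφ : ∀ p ∈ (A.bundle j).filter fun p => d ≤ (μ.symm p : ℕ),
        φ p ∈ (A.bundle i).filter fun p => (μ.symm p : ℕ) + d < m := by
      intro p hp
      rw [Finset.mem_filter, memb] at hp ⊢
      simp only [φ, Equiv.symm_apply_apply]
      refine ⟨Nat.ModEq.add_right_cancel' d ?_, ?_⟩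
      · rw [Nat.sub_add_cancel hp.2]
        exact hp.1.trans hdij.symm
      · rw [Nat.sub_add_cancel hp.2]
        exact (μ.symm p).2
    calc ∑ p ∈ (A.bundle j).filter (fun p => d ≤ (μ.symm p : ℕ)), I.value i p
        ≤ ∑ p ∈ (A.bundle j).filter (fun p => d ≤ (μ.symm p : ℕ)), I.value i (φ p) := by
          refine Finset.sum_le_sum fun p hp => ?_
          have h1 := (memb _ _).1 (Finset.mem_filter.1 (hφ p hp)).1
          have h2 := h.weight_le (q := μ.symm (φ p)) (r := μ.symm p) (by
            simp [φ, Fin.le_def])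
          have h3 : positionTeam (μ.symm (φ p)) = i := by
            rw [← hA]
            exact mem_bundle.1 (Finset.mem_filter.1 (hφ p hp)).1
          simpa [FairInstance.weight, h3] using h2
      _ = ∑ p ∈ (A.bundle i).filter (fun p => (μ.symm p : ℕ) + d < m), I.value i p := by
          refine Finset.sum_bij (fun p _ => φ p) hφ ?_ ?_ fun _ _ => rfl
          · intro p hp q hq hpq
            have := congrArg Fin.val (μ.injective hpq)
            have h1 := (Finset.mem_filter.1 hp).2
            have h2 := (Finset.mem_filter.1 hq).2
            apply μ.symm.injective
            ext
            simp only at this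
            omega
          · intro p hp
            rw [Finset.mem_filter, memb] at hp
            refine ⟨μ ⟨μ.symm p + d, hp.2⟩, ?_, ?_⟩
            · rw [Finset.mem_filter, memb]
              simp only [Equiv.symm_apply_apply, le_add_iff_nonneg_left, zero_le, and_true]
              exact (hp.1.add_right d).trans hdij
            · simp [φ]

theorem ef11_of_isLexMaxMatching (h : IsLexMaxMatching I μ)
    (hA : ∀ p, A p = positionTeam (μ.symm p)) : I.EF11 A :=
  fun _ _ _ => exists_exceptional_players h hA

/-- If values are nonnegative, returning `X` to the bundle of `i` does not lower its value. If they
are nonpositive, returning `Y` to the bundle of `j` does not raise its value. -/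
theorem ef1_of_isLexMaxMatching (h : IsLexMaxMatching I μ)
    (hA : ∀ p, A p = positionTeam (μ.symm p)) (hs : I.NonnegativeValue ∨ I.NonpositiveValue) :
    I.EF1 A := by
  intro i j _
  obtain ⟨X, Y, hX, hY, hX1, hY1, hle⟩ := exists_exceptional_players h hA (i := i) (j := j)
  rcases hs with hs | hs
  · refine ⟨∅, Y, Finset.empty_subset _, hY, by simpa using hY1, hle.trans ?_⟩
    exact Finset.sum_le_sum_of_subset_of_nonneg
      (Finset.sdiff_subset_sdiff subset_rfl (Finset.empty_subset _)) fun p _ _ => hs i p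
  · refine ⟨X, ∅, hX, Finset.empty_subset _, by simpa using hX1, le_trans ?_ hle⟩
    have := Finset.sum_le_sum_of_subset_of_nonneg (f := fun p => -I.value i p)
      (Finset.sdiff_subset_sdiff subset_rfl (Finset.empty_subset Y) : A.bundle j \ Y ⊆ _)
      fun p _ _ => neg_nonneg.2 (hs i p)
    simpa [FairInstance.setValue] using this

theorem rankSum_eq (I : FairInstance n m) (ν : Fin m ≃ Fin m) :
    rankSum I ν = ∑ q, I.rank (ν q) (positionTeam q) := by
  unfold rankSum
  rw [← Equiv.sum_comp ν]
  simp

/-- A harmless exchange leaves both teams indifferent, so the exchanged matching competes in the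
second phase. A gain for one player without a loss for the other would then lower the rank sum. -/
theorem swapStable_of_isRankMinMatching (h : IsLexMaxMatching I μ) (hr : IsRankMinMatching I μ μ)
    (hA : ∀ p, A p = positionTeam (μ.symm p)) : I.SwapStable A := by
  have main : ∀ p q, μ.symm p ≤ μ.symm q → ¬ I.BeneficialSwap A p q := by
    rintro p q hle ⟨⟨h1, h2, h3, h4⟩, h5⟩
    by_cases hpq : A p = A q
    · have : (fun x => A (Equiv.swap p q x)) = A := by
        funext x
        by_cases hx : x = p
        · subst hx; simp [hpq]
        by_cases hx' : x = q
        · subst hx'; simp [hpq]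
        · rw [Equiv.swap_apply_of_ne_of_ne hx hx']
      simp [this, FairInstance.TeamBetterOff, FairInstance.PlayerBetterOff,
        FairInstance.StrictPref, hpq] at h5
    have hne : p ≠ q := fun h => hpq (h ▸ rfl)
    have e1 := I.setValue_swap_sub A hpq
    have e2 := I.setValue_swap_sub A (Ne.symm hpq)
    rw [Equiv.swap_comm q p] at e2
    have g1 := h.weight_le hle
    have ν_ne : ∀ r, r ≠ μ.symm p → r ≠ μ.symm q → Equiv.swap p q (μ r) = μ r := by
      intro r h1 h2
      refine Equiv.swap_apply_of_ne_of_ne ?_ ?_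
      · rintro rfl; simp at h1
      · rintro rfl; simp at h2
    have hlt : μ.symm p < μ.symm q := lt_of_le_of_ne hle fun h => hne (μ.symm.injective h)
    simp only [FairInstance.weight, Equiv.apply_symm_apply, ← hA] at g1
    simp only [FairInstance.TeamBetterOff, not_lt] at h1 h2
    -- The earlier team does not lose by hypothesis and does not gain because it envies no later
    -- position.
    have w1 : I.value (A p) q = I.value (A p) p := by linarith
    -- By `w1`, the exchanged matching ties with `μ` before the later position, so maximality
    -- applies at that position.
    have g2 := h (μ.symm q) (μ.trans (Equiv.swap p q)) fun r hr => by
      by_cases hrp : r = μ.symm p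
      · subst hrp
        simp [FairInstance.weight, ← hA, w1]
      · simp [ν_ne r hrp hr.ne]
    simp only [FairInstance.weight, Equiv.trans_apply, Equiv.apply_symm_apply, ← hA,
      Equiv.swap_apply_right] at g2
    have w2 : I.value (A q) p = I.value (A q) q := by linarith
    have hk : KeepsWeights I μ (μ.trans (Equiv.swap p q)) := by
      intro r
      by_cases hrp : r = μ.symm p
      · subst hrp
        simp [FairInstance.weight, ← hA, w1]
      by_cases hrq : r = μ.symm q
      · subst hrq
        simp [FairInstance.weight, ← hA, w2]
      · simp [ν_ne r hrp hrq]
    have hmin := hr.2 _ hk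
    have hteam : ∀ x, positionTeam ((μ.trans (Equiv.swap p q)).symm x) = A (Equiv.swap p q x) := by
      intro x
      rw [hA]
      simp
    unfold rankSum at hmin
    simp only [hteam, ← hA] at hmin
    have pref_of_not : ∀ x i j, ¬ I.StrictPref x i j → I.pref x j i := by
      intro x i j hs
      rcases I.pref_total x j i with h | h
      · exact h
      · by_contra h'
        exact hs ⟨h, h'⟩
    have hall : ∀ x ∈ (Finset.univ : Finset (Fin m)),
        I.rank x (A (Equiv.swap p q x)) ≤ I.rank x (A x) := by
      intro x _
      by_cases hx : x = p
      · subst hx; exact rank_le_of_pref (pref_of_not _ _ _ h3)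
      by_cases hx' : x = q
      · subst hx'; exact rank_le_of_pref (pref_of_not _ _ _ h4)
      · rw [Equiv.swap_apply_of_ne_of_ne hx hx']
    have hstrict : ∃ x ∈ (Finset.univ : Finset (Fin m)),
        I.rank x (A (Equiv.swap p q x)) < I.rank x (A x) := by
      rcases h5 with h5 | h5 | h5 | h5
      · unfold FairInstance.TeamBetterOff at h5; linarith
      · unfold FairInstance.TeamBetterOff at h5; linarith
      · exact ⟨p, Finset.mem_univ _, rank_lt_of_strictPref h5⟩
      · exact ⟨q, Finset.mem_univ _, rank_lt_of_strictPref h5⟩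
    exact absurd (Finset.sum_lt_sum hall hstrict) (not_lt.2 hmin)
  intro p q hb
  rcases le_total (μ.symm p) (μ.symm q) with hle | hle
  · exact main p q hle hb
  · exact main q p hle (FairInstance.BeneficialSwap.symm hb)

/-- Every output of the algorithm has the desired properties. -/
theorem IsAlgorithmOutput.properties (h : IsAlgorithmOutput I A) :
    A.Balanced ∧ I.EF11 A ∧ I.SwapStable A ∧
      (I.NonnegativeValue ∨ I.NonpositiveValue → I.EF1 A) := by
  obtain ⟨μ, ν, hμ, hν, hA⟩ := h
  have hl := hμ.of_keepsWeights hν.1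
  exact ⟨balanced_of_matching hA, ef11_of_isLexMaxMatching hl hA,
    swapStable_of_isRankMinMatching hl hν.self hA, ef1_of_isLexMaxMatching hl hA⟩

end Outputs

/-! ### One integral cost for both phases -/

section Cost

theorem horner_sum_succ (b k : ℕ) (f : ℕ → ℕ) :
    ∑ r ∈ Finset.range (k + 1), b ^ (k - r) * f r =
      b * ∑ r ∈ Finset.range k, b ^ (k - 1 - r) * f r + f k := by
  rw [Finset.sum_range_succ, Finset.mul_sum]
  simp only [Nat.sub_self, pow_zero, one_mul, Nat.add_right_cancel_iff]
  refine Finset.sum_congr rfl fun r hr => ?_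
  have := Finset.mem_range.1 hr
  rw [← mul_assoc, ← pow_succ']
  congr 2
  omega

/-- Digit strings are compared lexicographically. -/
theorem horner_sum_lt {m q : ℕ} {f g : ℕ → ℕ} (hf : ∀ r, f r ≤ m) (heq : ∀ r < q, f r = g r)
    (hlt : f q < g q) (k : ℕ) :
    ∑ r ∈ Finset.range (q + k + 1), (m + 1) ^ (q + k - r) * f r <
      ∑ r ∈ Finset.range (q + k + 1), (m + 1) ^ (q + k - r) * g r := by
  -- `k` counts the digits after the first difference, which is at `q`.
  induction k with
  | zero =>
    rw [add_zero, horner_sum_succ, horner_sum_succ]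
    have : ∑ r ∈ Finset.range q, (m + 1) ^ (q - 1 - r) * f r =
        ∑ r ∈ Finset.range q, (m + 1) ^ (q - 1 - r) * g r :=
      Finset.sum_congr rfl fun r hr => by rw [heq r (Finset.mem_range.1 hr)]
    rw [this]
    omega
  | succ k ih =>
    rw [show q + (k + 1) = q + k + 1 by ring, horner_sum_succ, horner_sum_succ]
    simp only [Nat.add_sub_cancel]
    set F := ∑ r ∈ Finset.range (q + k + 1), (m + 1) ^ (q + k - r) * f r
    set G := ∑ r ∈ Finset.range (q + k + 1), (m + 1) ^ (q + k - r) * g r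
    have h1 := hf (q + k + 1)
    -- A gap of at least one becomes at least `m + 1` in the next place, more than the next digit of
    -- `f` can make up.
    have h2 : (m + 1) * (F + 1) ≤ (m + 1) * G := Nat.mul_le_mul_left _ ih
    rw [mul_add] at h2
    omega

/-- Scaling turns a strict inequality of digit sums into a gap of at least `N + 1`, which the
lower-order term `a ≤ N` cannot bridge. -/
theorem scaled_sum_lt {m N a b : ℕ} {f g : Fin m → ℕ} {q : Fin m} (hf : ∀ r, f r ≤ m)
    (heq : ∀ r < q, f r = g r) (hlt : f q < g q) (ha : a ≤ N) :
    ∑ r : Fin m, (N + 1) * (m + 1) ^ (m - 1 - (r : ℕ)) * f r + a <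
      ∑ r : Fin m, (N + 1) * (m + 1) ^ (m - 1 - (r : ℕ)) * g r + b := by
  let ext : (Fin m → ℕ) → ℕ → ℕ := fun f r => if h : r < m then f ⟨r, h⟩ else 0
  have hext : ∀ f : Fin m → ℕ, ∀ r : Fin m, f r = ext f r := fun f r => by simp [ext]
  have hsum : ∀ f : Fin m → ℕ, ∑ r : Fin m, (N + 1) * (m + 1) ^ (m - 1 - (r : ℕ)) * f r =
      (N + 1) * ∑ r ∈ Finset.range m, (m + 1) ^ (m - 1 - r) * ext f r := by
    intro f
    rw [Finset.mul_sum, ← Fin.sum_univ_eq_sum_range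
      (fun r => (N + 1) * ((m + 1) ^ (m - 1 - r) * ext f r))]
    refine Finset.sum_congr rfl fun r _ => ?_
    rw [hext f r, mul_assoc]
  rw [hsum, hsum]
  have hq := q.2
  have := horner_sum_lt (m := m) (q := q) (f := ext f) (g := ext g)
    (fun r => by
      by_cases h : r < m
      · simpa [ext, h] using hf ⟨r, h⟩
      · simp [ext, h])
    (fun r hr => by
      have : r < m := hr.trans q.2
      simpa [ext, this] using heq ⟨r, this⟩ hr)
    (by simpa [ext] using hlt) (m - 1 - q)
  rw [show (q : ℕ) + (m - 1 - q) = m - 1 by omega, show m - 1 + 1 = m by omega] at this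
  have := Nat.mul_le_mul_left (N + 1) (Nat.succ_le_of_lt this)
  rw [Nat.mul_succ] at this
  omega

variable {n m : ℕ} [NeZero n] (I : FairInstance n m)

open Classical in
/-- The number of players of larger value for the team of the position. -/
noncomputable def FairInstance.ordinal (q p : Fin m) : ℕ :=
  (Finset.univ.filter fun x => I.weight q p < I.weight q x).card

/-- An integral cost whose minimisation is equivalent to the two optimisation phases. -/
noncomputable def FairInstance.cost (q p : Fin m) : ℕ :=
  (n * m + 1) * (m + 1) ^ (m - 1 - (q : ℕ)) * I.ordinal q p + I.rank p (positionTeam q)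

variable {I}

theorem ordinal_le (q p : Fin m) : I.ordinal q p ≤ m := by
  classical
  exact (Finset.card_le_univ _).trans (by simp)

theorem ordinal_lt {q p p' : Fin m} (h : I.weight q p < I.weight q p') :
    I.ordinal q p' < I.ordinal q p := by
  classical
  refine Finset.card_lt_card ⟨fun x hx => ?_, fun hs => ?_⟩
  · simp only [Finset.mem_filter, Finset.mem_univ, true_and] at hx ⊢
    exact h.trans hx
  · have : p' ∈ Finset.univ.filter fun x => I.weight q p' < I.weight q x := hs (by simpa using h)
    simp at this

theorem ordinal_congr {q p p' : Fin m} (h : I.weight q p = I.weight q p') :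
    I.ordinal q p = I.ordinal q p' := by
  simp [FairInstance.ordinal, h]

theorem sum_rank_le (ν : Fin m ≃ Fin m) :
    ∑ q, I.rank (ν q) (positionTeam q) ≤ n * m := by
  refine (Finset.sum_le_card_nsmul _ _ n fun q _ => rank_le _ _).trans ?_
  simp [mul_comm]

variable {μ : Fin m ≃ Fin m}

/-- A matching that ties before `q` and has larger weight at `q` has equal ordinals before `q` and a
smaller one at `q`. It would be cheaper, whatever happens later and whatever the ranks are. -/
theorem isLexMaxMatching_of_cost_le
    (h : ∀ ν : Fin m ≃ Fin m, ∑ q, I.cost q (μ q) ≤ ∑ q, I.cost q (ν q)) :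
    IsLexMaxMatching I μ := by
  intro q ν hν
  by_contra! hlt
  refine absurd (h ν) (not_le.2 ?_)
  unfold FairInstance.cost
  rw [Finset.sum_add_distrib, Finset.sum_add_distrib]
  exact scaled_sum_lt (q := q) (fun r => ordinal_le _ _) (fun r hr => ordinal_congr (hν r hr))
    (ordinal_lt hlt) (sum_rank_le ν)

/-- Matchings that keep the weights have the same ordinals. These cancel, and the comparison of
costs becomes one of rank sums. -/
theorem isRankMinMatching_of_cost_le
    (h : ∀ ν : Fin m ≃ Fin m, ∑ q, I.cost q (μ q) ≤ ∑ q, I.cost q (ν q)) :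
    IsRankMinMatching I μ μ := by
  refine ⟨fun _ => rfl, fun ν hν => ?_⟩
  have := h ν
  unfold FairInstance.cost at this
  rw [Finset.sum_add_distrib, Finset.sum_add_distrib] at this
  simp only [fun q => ordinal_congr (hν q)] at this
  rw [rankSum_eq, rankSum_eq]
  omega

theorem isAlgorithmOutput_of_cost_le
    (h : ∀ ν : Fin m ≃ Fin m, ∑ q, I.cost q (μ q) ≤ ∑ q, I.cost q (ν q)) :
    IsAlgorithmOutput I fun p => positionTeam (μ.symm p) :=
  ⟨μ, μ, isLexMaxMatching_of_cost_le h, isRankMinMatching_of_cost_le h, fun _ => rfl⟩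

variable (I) in
theorem exists_isAlgorithmOutput : ∃ A : Allocation n m, IsAlgorithmOutput I A := by
  obtain ⟨μ, hμ⟩ := Finite.exists_min fun μ : Fin m ≃ Fin m => ∑ q, I.cost q (μ q)
  exact ⟨_, isAlgorithmOutput_of_cost_le hμ⟩

end Cost

/-! ### Reading the memory after an update -/

namespace Memory

variable (s : Memory) (x y a b j k : ℕ)

@[simp] theorem setVar_var_self : (s.setVar x k).var x = k := Function.update_self _ _ _

@[simp] theorem setVar_arr : (s.setVar x k).arr = s.arr := rfl

@[simp] theorem setArr_var : (s.setArr a j k).var = s.var := rfl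

@[simp] theorem setArr_arr_self :
    (s.setArr a j k).arr a = Function.update (s.arr a) j k := Function.update_self _ _ _

variable {x y a b}

@[simp] theorem setVar_var_of_ne (h : y ≠ x) : (s.setVar x k).var y = s.var y :=
  Function.update_of_ne h _ _

@[simp] theorem setArr_arr_of_ne (h : b ≠ a) : (s.setArr a j k).arr b = s.arr b :=
  Function.update_of_ne h _ _

end Memory

/-! ### Counting loops

Programs whose only loops count up to the number of teams or players terminate in polynomial time,
and so have a total denotation. -/

/-- Programs with counting loops: `rep x b c` runs `c` for `x = 0, 1, …` below variable `b`. -/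
inductive Prog where
  | assign (x : ℕ) (e : NExp)
  | store (a : ℕ) (e₁ e₂ : NExp)
  | seq (c₁ c₂ : Prog)
  | ite (b : BExp) (c : Prog)
  | rep (x b : ℕ) (c : Prog)

namespace Prog

/-- The machine program. -/
def toCmd : Prog → Cmd
  | assign x e => .assign x e
  | store a e₁ e₂ => .store a e₁ e₂
  | seq c₁ c₂ => .seq c₁.toCmd c₂.toCmd
  | ite b c => .ite b c.toCmd .skip
  | rep x b c => .seq (.assign x (.lit 0))
      (.loop (.not (.le (.var b) (.var x))) (.seq c.toCmd (.assign x (.add (.var x) (.lit 1)))))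

/-- The variables that are assigned. -/
def vars : Prog → List ℕ
  | assign x _ => [x]
  | store _ _ _ => []
  | seq c₁ c₂ => c₁.vars ++ c₂.vars
  | ite _ c => c.vars
  | rep x _ c => x :: c.vars

/-- The arrays that are modified. -/
def arrs : Prog → List ℕ
  | assign _ _ => []
  | store a _ _ => [a]
  | seq c₁ c₂ => c₁.arrs ++ c₂.arrs
  | ite _ c => c.arrs
  | rep _ _ c => c.arrs

/-- Loop counters are not assigned in the loop body, and the bounds are the two input variables,
which are never assigned. -/
def WellFormed : Prog → Prop
  | assign x _ => 2 ≤ x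
  | store _ _ _ => True
  | seq c₁ c₂ => c₁.WellFormed ∧ c₂.WellFormed
  | ite _ c => c.WellFormed
  | rep x b c => 2 ≤ x ∧ b < 2 ∧ x ∉ c.vars ∧ c.WellFormed

/-- A bound on the running time. -/
noncomputable def time : Prog → Polynomial ℕ
  | assign _ e => .C (e.cost + 1)
  | store _ e₁ e₂ => .C (e₁.cost + e₂.cost + 1)
  | seq c₁ c₂ => c₁.time + c₂.time
  | ite b c => .C (b.cost + 2) + c.time
  | rep _ _ c => .C 7 + .X * (c.time + .C 9)

variable {n m : ℕ} (I : FairInstance n m)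

open Classical in
/-- The effect on the memory. -/
noncomputable def run : Prog → Memory → Memory
  | assign x e, s => s.setVar x (e.eval s)
  | store a e₁ e₂, s => s.setArr a (e₁.eval s) (e₂.eval s)
  | seq c₁ c₂, s => c₂.run (c₁.run s)
  | ite b c, s => if b.eval I s then c.run s else s
  | rep x b c, s => (fun s => (c.run s).setVar x ((c.run s).var x + 1))^[s.var b] (s.setVar x 0)

variable {I}

@[simp]
theorem run_assign (x : ℕ) (e : NExp) (s : Memory) :
    (assign x e).run I s = s.setVar x (e.eval s) := rfl

@[simp]
theorem run_store (a : ℕ) (e₁ e₂ : NExp) (s : Memory) :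
    (store a e₁ e₂).run I s = s.setArr a (e₁.eval s) (e₂.eval s) := rfl

@[simp]
theorem run_seq (c₁ c₂ : Prog) (s : Memory) : (seq c₁ c₂).run I s = c₂.run I (c₁.run I s) := rfl

theorem run_ite_of_true {b : BExp} {s : Memory} (h : b.eval I s) (c : Prog) :
    (ite b c).run I s = c.run I s := if_pos h

theorem run_ite_of_false {b : BExp} {s : Memory} (h : ¬ b.eval I s) (c : Prog) :
    (ite b c).run I s = s := if_neg h

/-- A frame rule. Its side condition is syntactic, so for concrete programs `decide` or `simp`
discharges it; `run_arr` is the analogue for arrays. -/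
theorem run_var {c : Prog} {s : Memory} {y : ℕ} (hy : y ∉ c.vars) :
    (c.run I s).var y = s.var y := by
  induction c generalizing s with
  | assign x e =>
    simp only [vars, List.mem_singleton] at hy
    simp [run, Memory.setVar, hy]
  | store a e₁ e₂ => rfl
  | seq c₁ c₂ ih₁ ih₂ =>
    simp only [vars, List.mem_append, not_or] at hy
    rw [run, ih₂ hy.2, ih₁ hy.1]
  | ite b c ih =>
    rw [run]
    split_ifs
    · exact ih hy
    · rfl
  | rep x b c ih =>
    simp only [vars, List.mem_cons, not_or] at hy
    rw [run]
    induction s.var b with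
    | zero => simp [Memory.setVar, hy.1]
    | succ k ihk =>
      rw [Function.iterate_succ_apply']
      simp only [Memory.setVar, ne_eq, hy.1, not_false_eq_true, Function.update_of_ne]
      rw [ih hy.2]
      exact ihk

theorem run_arr {c : Prog} {s : Memory} {a : ℕ} (ha : a ∉ c.arrs) :
    (c.run I s).arr a = s.arr a := by
  induction c generalizing s with
  | assign x e => rfl
  | store a e₁ e₂ =>
    simp only [arrs, List.mem_singleton] at ha
    simp [run, Memory.setArr, ha]
  | seq c₁ c₂ ih₁ ih₂ =>
    simp only [arrs, List.mem_append, not_or] at ha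
    rw [run, ih₂ ha.2, ih₁ ha.1]
  | ite b c ih =>
    rw [run]
    split_ifs
    · exact ih ha
    · rfl
  | rep x b c ih =>
    rw [run]
    induction s.var b with
    | zero => rfl
    | succ k ihk =>
      rw [Function.iterate_succ_apply']
      exact (ih ha).trans ihk

theorem WellFormed.two_le {c : Prog} (hc : c.WellFormed) {x : ℕ} (hx : x ∈ c.vars) : 2 ≤ x := by
  induction c with
  | assign y e =>
    simp only [vars, List.mem_singleton] at hx
    exact hx ▸ hc
  | store a e₁ e₂ => simp [vars] at hx
  | seq c₁ c₂ ih₁ ih₂ =>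
    simp only [vars, List.mem_append] at hx
    exact hx.elim (ih₁ hc.1) (ih₂ hc.2)
  | ite b c ih => exact ih hc hx
  | rep y b c ih =>
    simp only [vars, List.mem_cons] at hx
    exact hx.elim (fun h => h ▸ hc.1) (ih hc.2.2.2)

/-- Loop bounds stay fixed while a loop runs, which makes the number of iterations known in advance.
-/
theorem WellFormed.run_var_of_lt {c : Prog} (hc : c.WellFormed) {s : Memory} {b : ℕ} (hb : b < 2) :
    (c.run I s).var b = s.var b :=
  run_var fun h => absurd (hc.two_le h) (not_le.2 hb)

/-- Counting programs run in polynomial time. -/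
theorem exec_toCmd {c : Prog} (hc : c.WellFormed) {s : Memory} {N : ℕ} (hN : ∀ b < 2, s.var b ≤ N) :
    ∃ t ≤ c.time.eval N, Exec I c.toCmd s (c.run I s) t := by
  induction c generalizing s with
  | assign x e => exact ⟨_, by simp [time], .assign x e s⟩
  | store a e₁ e₂ => exact ⟨_, by simp [time], .store a e₁ e₂ s⟩
  | seq c₁ c₂ ih₁ ih₂ =>
    obtain ⟨t₁, h₁, e₁⟩ := ih₁ hc.1 hN
    obtain ⟨t₂, h₂, e₂⟩ := ih₂ hc.2 (s := c₁.run I s) fun b hb => by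
      rw [hc.1.run_var_of_lt hb]
      exact hN b hb
    exact ⟨_, by simpa [time] using Nat.add_le_add h₁ h₂, .seq e₁ e₂⟩
  | ite b c ih =>
    rw [run]
    split_ifs with hb
    · obtain ⟨t, h, e⟩ := ih hc hN
      exact ⟨_, by simp [time]; omega, .ite_true hb e⟩
    · exact ⟨_, by simp [time]; omega, .ite_false hb (.skip s)⟩
  | rep x b c ih =>
    obtain ⟨hx, hb, hxc, hc⟩ := hc
    have hbx : b ≠ x := by omega
    -- The failing last test costs 5. A round costs 5 for the test, the time of the body, and 4 for
    -- the increment.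
    have loop : ∀ k (s : Memory), s.var x + k = s.var b → (∀ b < 2, s.var b ≤ N) →
        ∃ t ≤ 5 + k * (c.time.eval N + 9), Exec I
          (.loop (.not (.le (.var b) (.var x)))
            (.seq c.toCmd (.assign x (.add (.var x) (.lit 1))))) s
          ((fun s => (c.run I s).setVar x ((c.run I s).var x + 1))^[k] s) t := by
      intro k
      induction k with
      | zero =>
        intro s hs _
        refine ⟨_, ?_, .loop_done ?_⟩
        · simp [BExp.cost, NExp.cost]
        · simp only [BExp.eval, NExp.eval, not_not]
          omega
      | succ k ihk =>
        intro s hs hN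
        obtain ⟨t, h, e⟩ := ih hc hN
        have hvx := run_var (I := I) (s := s) hxc
        have hvb := fun b hb => hc.run_var_of_lt (I := I) (s := s) (b := b) hb
        obtain ⟨t', h', e'⟩ := ihk ((c.run I s).setVar x ((c.run I s).var x + 1))
          (by
            have := hvb b hb
            simp only [Memory.setVar, Function.update_self, ne_eq, hbx, not_false_eq_true,
              Function.update_of_ne]
            omega)
          (fun b hb => by
            have := hvb b hb
            have hbx : b ≠ x := by omega
            have := hN b hb
            simp only [Memory.setVar, ne_eq, hbx, not_false_eq_true, Function.update_of_ne]
            omega)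
        refine ⟨_, ?_, .loop_step ?_ (.seq e (.assign x _ _)) e'⟩
        · simp only [BExp.cost, NExp.cost, Nat.succ_mul]
          omega
        · simp only [BExp.eval, NExp.eval]
          omega
    obtain ⟨t, h, e⟩ := loop (s.var b) (s.setVar x 0)
      (by simp [Memory.setVar, hbx])
      (fun b hb => by
        have hbx : b ≠ x := by omega
        simpa [Memory.setVar, hbx] using hN b hb)
    refine ⟨_, ?_, .seq (.assign x (.lit 0) s) e⟩
    have := Nat.mul_le_mul_right (c.time.eval N + 9) (hN b hb)
    simp only [time, NExp.cost, Polynomial.eval_add, Polynomial.eval_C, Polynomial.eval_mul,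
      Polynomial.eval_X]
    omega

/-- Reasoning about a counting loop with an invariant. -/
theorem run_rep_induction {c : Prog} {x b N : ℕ} {s : Memory} (P : ℕ → Memory → Prop)
    (hN : s.var b = N) (hx : x ∉ c.vars) (h0 : P 0 (s.setVar x 0))
    (hstep : ∀ i < N, ∀ s' : Memory, s'.var x = i →
      (∀ y, y ≠ x → y ∉ c.vars → s'.var y = s.var y) → (∀ a ∉ c.arrs, s'.arr a = s.arr a) →
      P i s' → P (i + 1) ((c.run I s').setVar x (i + 1))) :
    P N ((rep x b c).run I s) := by
  subst hN
  rw [run]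
  set F : Memory → Memory := fun s => (c.run I s).setVar x ((c.run I s).var x + 1)
  -- The invariant is strengthened by the value of the counter and by the frame conditions, which
  -- `hstep` may then assume.
  have main : ∀ i ≤ s.var b, P i (F^[i] (s.setVar x 0)) ∧ (F^[i] (s.setVar x 0)).var x = i ∧
      (∀ y, y ≠ x → y ∉ c.vars → (F^[i] (s.setVar x 0)).var y = s.var y) ∧
      (∀ a ∉ c.arrs, (F^[i] (s.setVar x 0)).arr a = s.arr a) := by
    intro i hi
    induction i with
    | zero =>
      refine ⟨h0, by simp [Memory.setVar], fun y hy _ => ?_, fun _ _ => rfl⟩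
      simp [Memory.setVar, hy]
    | succ i ih =>
      obtain ⟨h1, h2, h3, h4⟩ := ih (by omega)
      rw [Function.iterate_succ_apply']
      have hF : F (F^[i] (s.setVar x 0)) = (c.run I (F^[i] (s.setVar x 0))).setVar x (i + 1) := by
        simp only [F]
        rw [run_var hx, h2]
      rw [hF]
      refine ⟨hstep i (by omega) _ h2 h3 h4 h1, by simp [Memory.setVar], fun y hy hyc => ?_,
        fun a ha => ?_⟩
      · exact (Function.update_of_ne hy _ _).trans ((run_var hyc).trans (h3 y hy hyc))
      · exact (run_arr ha).trans (h4 a ha)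
  exact (main _ le_rfl).1

/-- Multiplication by repeated addition. -/
theorem run_rep_add {x b y z : ℕ} {s : Memory} (hxy : x ≠ y) (hzx : z ≠ x) (hzy : z ≠ y) :
    ((rep x b (.assign y (.add (.var y) (.var z)))).run I s).var y =
      s.var y + s.var b * s.var z := by
  refine run_rep_induction (fun i t => t.var y = s.var y + i * s.var z) rfl
    (by simpa [vars] using hxy) (by simp [hxy.symm]) fun i _ t _ hvar _ hP => ?_
  have := hvar z hzx (by simpa [vars] using hzy)
  simp only [run_assign, NExp.eval, ne_eq, hxy.symm, not_false_eq_true, Memory.setVar_var_of_ne,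
    Memory.setVar_var_self]
  rw [hP, this]
  ring

/-- Counting the solutions of a test. -/
theorem run_rep_count {x b y N w : ℕ} {B : BExp} {e : NExp} {s : Memory} (P : Fin N → Prop)
    [DecidablePred P] (hN : s.var b = N) (hxy : x ≠ y)
    (h : ∀ (i : Fin N) (t : Memory), t.var x = i → (∀ z, z ≠ x → z ≠ y → t.var z = s.var z) →
      t.arr = s.arr → (B.eval I t ↔ P i) ∧ e.eval t = w) :
    ((rep x b (.ite B (.assign y (.add (.var y) e)))).run I s).var y =
      s.var y + w * (Finset.univ.filter P).card := by
  have := run_rep_induction (I := I) (s := s) (x := x) (N := N)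
    (c := .ite B (.assign y (.add (.var y) e)))
    (fun i t => t.var y = s.var y + w *
      (Finset.univ.filter fun z : Fin N => (z : ℕ) < i ∧ P z).card) hN
    (by simpa [vars] using hxy) (by simp [hxy.symm]) (by
    intro i hi t hx hvar harr hP
    obtain ⟨hB, he⟩ := h ⟨i, hi⟩ t hx (fun z h1 h2 => hvar z h1 (by simpa [vars] using h2))
      (funext fun a => harr a (by simp [arrs]))
    rw [Memory.setVar_var_of_ne _ _ hxy.symm]
    have hi' : ∀ z : Fin N, (z : ℕ) < i + 1 ↔ z = ⟨i, hi⟩ ∨ (z : ℕ) < i := fun z => by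
      rw [Fin.ext_iff]
      simp only
      omega
    by_cases hc : P ⟨i, hi⟩
    · have hf : (Finset.univ.filter fun z : Fin N => (z : ℕ) < i + 1 ∧ P z) =
          insert ⟨i, hi⟩ (Finset.univ.filter fun z : Fin N => (z : ℕ) < i ∧ P z) := by
        ext z
        simp only [Finset.mem_filter, Finset.mem_univ, true_and, hi', Finset.mem_insert]
        constructor
        · tauto
        · rintro (rfl | h') <;> tauto
      rw [run_ite_of_true (hB.2 hc), hf, Finset.card_insert_of_notMem (by simp)]
      simp only [run_assign, NExp.eval, Memory.setVar_var_self, hP, he]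
      ring
    · have hf : (Finset.univ.filter fun z : Fin N => (z : ℕ) < i + 1 ∧ P z) =
          Finset.univ.filter fun z : Fin N => (z : ℕ) < i ∧ P z := by
        ext z
        simp only [Finset.mem_filter, Finset.mem_univ, true_and, hi']
        constructor
        · rintro ⟨rfl | h', h''⟩ <;> tauto
        · tauto
      rw [run_ite_of_false (hB.not.2 hc), hf, hP])
  rw [this]
  congr 3
  ext z
  simp

/-- Filling distinct cells of an array. -/
theorem run_rep_store {x b a N : ℕ} {e₁ e₂ : NExp} {s : Memory} (f g : ℕ → ℕ) (hN : s.var b = N)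
    (hf : ∀ i < N, ∀ j < N, f i = f j → i = j)
    (h : ∀ i < N, ∀ t : Memory, t.var x = i → (∀ y, y ≠ x → t.var y = s.var y) →
      (∀ a', a' ≠ a → t.arr a' = s.arr a') →
      (∀ j, (∀ i < N, j ≠ f i) → t.arr a j = s.arr a j) → e₁.eval t = f i ∧ e₂.eval t = g i) :
    (∀ i < N, ((rep x b (.store a e₁ e₂)).run I s).arr a (f i) = g i) ∧
      ∀ j, (∀ i < N, j ≠ f i) → ((rep x b (.store a e₁ e₂)).run I s).arr a j = s.arr a j := by
  have := run_rep_induction (I := I) (s := s) (x := x) (N := N) (c := .store a e₁ e₂)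
    (fun i t => (∀ j < i, t.arr a (f j) = g j) ∧
      ∀ j, (∀ i < N, j ≠ f i) → t.arr a j = s.arr a j) hN (by simp [vars]) (by simp) (by
    intro i hi t hx hvar harr ⟨h1, h2⟩
    obtain ⟨e, e'⟩ := h i hi t hx (fun y hy => hvar y hy (by simp [vars]))
      (fun a' ha => harr a' (by simpa [arrs] using ha)) h2
    simp only [run_store, Memory.setVar_arr, Memory.setArr_arr_self, e, e', Function.update_apply]
    refine ⟨fun j hj => ?_, fun j hj => ?_⟩
    · by_cases hji : j = i
      · simp [hji]
      · rw [if_neg fun h => hji (hf j (by omega) i hi h)]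
        exact h1 j (by omega)
    · rw [if_neg (hj i hi)]
      exact h2 j hj)
  exact this

end Prog

/-! ### The Hungarian method

Rows and columns are added one at a time.  A matching of the first rows and columns is kept together
with dual variables `U` (rows) and `V` (columns, with the sign that makes them nonnegative). -/

/-- `M` matches the first `k` rows and columns optimally, as certified by `U` and `V`; the sum `S`
of all changes bounds the dual variables of the rows. -/
structure DualCertificate (c : ℕ → ℕ → ℕ) (m k : ℕ) (M U V : ℕ → ℕ) (S : ℕ) : Prop where
  lt : ∀ q < k, M q < k
  inj : ∀ q < k, ∀ r < k, M q = M r → q = r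
  eq_self : ∀ q, k ≤ q → q < m → M q = q
  le : ∀ q < k, ∀ p < k, U q ≤ c q p + V p
  tight : ∀ q < k, U q = c q (M q) + V (M q)
  row_le : ∀ q < m, U q ≤ S
  row_eq_zero : ∀ q, k ≤ q → q < m → U q = 0

/-- The search for a matching of one more row and column `k`: `R` marks the rows `r` that are
reached by alternating paths from `k`, and `G r` is the matching that exposes `r` instead of `k`. -/
structure SearchTree (c : ℕ → ℕ → ℕ) (m k i : ℕ) (M U V R : ℕ → ℕ) (G : ℕ → ℕ → ℕ) (S : ℕ) :
    Prop where
  lt : ∀ q ≤ k, M q ≤ k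
  inj : ∀ q ≤ k, ∀ r ≤ k, M q = M r → q = r
  root_eq : M k = k
  le : ∀ q ≤ k, ∀ p ≤ k, U q ≤ c q p + V p
  tight : ∀ q < k, U q = c q (M q) + V (M q)
  row_le : ∀ q < m, U q ≤ S
  row_eq_zero : ∀ q, k < q → q < m → U q = 0
  root : R k = 1
  reached_le : ∀ r < m, R r = 1 → r ≤ k
  path_lt : ∀ r ≤ k, R r = 1 → ∀ q ≤ k, G r q ≤ k
  path_inj : ∀ r ≤ k, R r = 1 → ∀ q ≤ k, ∀ q' ≤ k, G r q = G r q' → q = q'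
  path_eq_self : ∀ r ≤ k, R r = 1 → ∀ q, k < q → q < m → G r q = q
  path_exposed : ∀ r ≤ k, R r = 1 → G r r = k
  path_of_not_reached : ∀ r ≤ k, R r = 1 → ∀ q ≤ k, R q ≠ 1 → G r q = M q
  path_of_reached : ∀ r ≤ k, R r = 1 → ∀ q ≤ k, q ≠ r → R q = 1 →
    ∃ q' ≤ k, R q' = 1 ∧ q' ≠ k ∧ G r q = M q'
  path_tight : ∀ r ≤ k, R r = 1 → ∀ q ≤ k, q ≠ r → U q = c q (G r q) + V (G r q)
  card : ((Finset.range m).filter fun r => R r = 1).card = i + 1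

variable {c : ℕ → ℕ → ℕ} {m k i S δ : ℕ} {M U V R M' U' V' R' : ℕ → ℕ} {G G' : ℕ → ℕ → ℕ}

/-- Lets every column be addressed through the row matched to it, which is how the search and the
updates of `V` refer to columns. -/
theorem exists_eq_of_injOn_of_le {M : ℕ → ℕ} (lt : ∀ q ≤ k, M q ≤ k)
    (inj : ∀ q ≤ k, ∀ r ≤ k, M q = M r → q = r) {p : ℕ} (hp : p ≤ k) : ∃ q ≤ k, M q = p := by
  have := Finset.surjOn_of_injOn_of_card_le (s := Finset.range (k + 1)) (t := Finset.range (k + 1))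
    M (fun q hq => by
      have := lt q (by simpa [Nat.lt_succ_iff] using hq)
      simpa [Nat.lt_succ_iff] using this)
    (fun q hq r hr h => inj q (by simpa [Nat.lt_succ_iff] using hq) r
      (by simpa [Nat.lt_succ_iff] using hr) h) le_rfl
  obtain ⟨q, hq, h⟩ := this (show p ∈ _ by simpa [Nat.lt_succ_iff] using hp)
  exact ⟨q, by simpa [Nat.lt_succ_iff] using hq, h⟩

/-- The dual value `S` of the new column dominates every `U q`, so its constraints hold for any
nonnegative costs. The new row has dual value zero, so its constraints are trivial. The pair of row
`k` and column `k` is only formal and need not be tight. -/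
theorem DualCertificate.start (h : DualCertificate c m k M U V S) (hk : k < m)
    (hV : ∀ p < m, V' p = if p = k then S else V p)
    (hR : ∀ r < m, R r = if r = k then 1 else 0) (hG : ∀ q < m, G k q = M q) :
    SearchTree c m k 0 M U V' R G S := by
  have hMk := h.eq_self k le_rfl hk
  have lt : ∀ q ≤ k, M q ≤ k := fun q hq => by
    rcases hq.eq_or_lt with rfl | hq
    · exact hMk.le
    · exact (h.lt q hq).le
  have inj : ∀ q ≤ k, ∀ r ≤ k, M q = M r → q = r := by
    intro q hq r hr hqr
    rcases hq.eq_or_lt with rfl | hq <;> rcases hr.eq_or_lt with rfl | hr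
    · rfl
    · have := h.lt r hr; omega
    · have := h.lt q hq; omega
    · exact h.inj q hq r hr hqr
  have root : ∀ r ≤ k, R r = 1 → r = k := fun r hr hr1 => by
    rw [hR r (by omega)] at hr1
    by_contra hne
    simp [hne] at hr1
  have tight : ∀ q < k, U q = c q (M q) + V' (M q) := fun q hq => by
    have := h.lt q hq
    rw [hV _ (by omega), if_neg (by omega)]
    exact h.tight q hq
  refine ⟨lt, inj, hMk, ?_, tight, h.row_le, fun q hq => h.row_eq_zero q hq.le,
    by simp [hR k hk], ?_, ?_, ?_, ?_, ?_, ?_, ?_, ?_, ?_⟩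
  · intro q hq p hp
    rw [hV p (by omega)]
    split_ifs with hpk
    · have := h.row_le q (by omega)
      omega
    · rcases hq.eq_or_lt with rfl | hq
      · rw [h.row_eq_zero q le_rfl hk]
        omega
      · exact h.le q hq p (by omega)
  · intro r hr hr1
    rw [hR r hr] at hr1
    by_contra hne
    rw [if_neg (by omega)] at hr1
    omega
  · intro r hr hr1 q hq
    rw [root r hr hr1, hG q (by omega)]
    exact lt q hq
  · intro r hr hr1 q hq q' hq'
    rw [root r hr hr1, hG q (by omega), hG q' (by omega)]
    exact inj q hq q' hq'
  · intro r hr hr1 q hq hqm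
    rw [root r hr hr1, hG q (by omega)]
    exact h.eq_self q hq.le hqm
  · intro r hr hr1
    rw [root r hr hr1, hG k (by omega)]
    exact hMk
  · intro r hr hr1 q hq _
    rw [root r hr hr1, hG q (by omega)]
  · intro r hr hr1 q hq hne hq1
    exact absurd ((root q hq hq1).trans (root r hr hr1).symm) hne
  · intro r hr hr1 q hq hne
    rw [root r hr hr1] at hne ⊢
    rw [hG q (by omega)]
    exact tight q (by omega)
  · rw [zero_add, Finset.card_eq_one]
    refine ⟨k, ?_⟩
    ext r
    simp only [Finset.mem_filter, Finset.mem_range, Finset.mem_singleton]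
    constructor
    · rintro ⟨hr, hr1⟩
      rw [hR r hr] at hr1
      by_contra hne
      simp [hne] at hr1
    · rintro rfl
      exact ⟨hk, by simp [hR r hk]⟩

/-- Raising the dual variables of the search tree. -/
theorem SearchTree.raise (h : SearchTree c m k i M U V R G S) (hk : k < m)
    (hδ : ∀ r ≤ k, R r = 1 → ∀ q ≤ k, R q ≠ 1 ∨ q = k → U r + δ ≤ c r (M q) + V (M q))
    (hU : ∀ r < m, U' r = U r + if R r = 1 then δ else 0)
    (hV : ∀ r ≤ k, V' (M r) = V (M r) + if R r = 1 ∧ r ≠ k then δ else 0) :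
    SearchTree c m k i M U' V' R G (S + δ) := by
  refine ⟨h.lt, h.inj, h.root_eq, ?_, ?_, ?_, ?_, h.root, h.reached_le, h.path_lt, h.path_inj,
    h.path_eq_self, h.path_exposed, h.path_of_not_reached, h.path_of_reached, ?_, h.card⟩
  · intro r hr p hp
    -- Slack can shrink only when the row is reached and the dual value of the column is not raised,
    -- and there it is at least `δ`.
    obtain ⟨q, hq, rfl⟩ := exists_eq_of_injOn_of_le h.lt h.inj hp
    rw [hU r (by omega), hV q hq]
    have h1 := hδ r hr
    have h2 := h.le r hr (M q) hp
    by_cases hr1 : R r = 1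
    · by_cases hq1 : R q = 1 ∧ q ≠ k
      · rw [if_pos hr1, if_pos hq1]
        omega
      · rw [if_pos hr1, if_neg hq1]
        have := h1 hr1 q hq (by tauto)
        omega
    · rw [if_neg hr1]
      omega
  · intro q hq
    rw [hU q (by omega), hV q (by omega)]
    have := h.tight q hq
    have hqk : q ≠ k := by omega
    by_cases hq1 : R q = 1
    · rw [if_pos hq1, if_pos ⟨hq1, hqk⟩]
      omega
    · rw [if_neg hq1, if_neg (by tauto)]
      omega
  · intro q hq
    rw [hU q hq]
    have := h.row_le q hq
    split_ifs <;> omega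
  · intro q hq hqm
    have h1 : R q ≠ 1 := fun h1 => by
      have := h.reached_le q hqm h1
      omega
    rw [hU q hqm, h.row_eq_zero q hq hqm, if_neg h1]
  · intro r hr hr1 q hq hne
    have ht := h.path_tight r hr hr1 q hq hne
    rw [hU q (by omega)]
    by_cases hq1 : R q = 1
    · obtain ⟨q', hq', hq1', hne', he⟩ := h.path_of_reached r hr hr1 q hq hne hq1
      rw [he] at ht ⊢
      rw [hV q' hq', if_pos hq1, if_pos ⟨hq1', hne'⟩]
      omega
    · have he := h.path_of_not_reached r hr hr1 q hq hq1
      rw [he] at ht ⊢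
      rw [hV q hq, if_neg hq1, if_neg (by tauto)]
      omega

variable {br bq : ℕ}

/-- Augmenting along a path to the exposed column. -/
theorem SearchTree.augment (h : SearchTree c m k i M U V R G S) (hk : k < m) (hbr : br ≤ k)
    (hbr1 : R br = 1) (ht : U br = c br (M k) + V (M k)) (hM' : ∀ q < m, M' q = G br q) :
    DualCertificate c m (k + 1) M' U V S := by
  refine ⟨?_, ?_, ?_, ?_, ?_, h.row_le, fun q hq => h.row_eq_zero q (by omega)⟩
  · intro q hq
    rw [hM' q (by omega)]
    have := h.path_lt br hbr hbr1 q (by omega)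
    omega
  · intro q hq r hr
    rw [hM' q (by omega), hM' r (by omega)]
    exact h.path_inj br hbr hbr1 q (by omega) r (by omega)
  · intro q hq hqm
    rw [hM' q hqm]
    exact h.path_eq_self br hbr hbr1 q (by omega) hqm
  · intro q hq p hp
    exact h.le q (by omega) p (by omega)
  · intro q hq
    rw [hM' q (by omega)]
    by_cases hqb : q = br
    · rw [hqb, h.path_exposed br hbr hbr1, ht, h.root_eq]
    · exact h.path_tight br hbr hbr1 q (by omega) hqb

/-- Adding a row to the search tree. -/
theorem SearchTree.grow (h : SearchTree c m k i M U V R G S) (hk : k < m) (hbr : br ≤ k)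
    (hbr1 : R br = 1) (hbq : bq ≤ k) (hbq1 : R bq ≠ 1) (ht : U br = c br (M bq) + V (M bq))
    (hR' : ∀ r, R' r = if r = bq then 1 else R r)
    (hG' : ∀ r < m, ∀ q < m, G' r q = if r = bq then
      (if q = bq then M k else if q = br then M bq else G br q) else G r q) :
    SearchTree c m k (i + 1) M U V R' G' S := by
  have hne : br ≠ bq := fun h => hbq1 (h ▸ hbr1)
  have hbk : bq ≠ k := fun hb => hbq1 (hb ▸ h.root)
  have hR : ∀ r, R' r = 1 ↔ r = bq ∨ R r = 1 := fun r => by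
    rw [hR']
    split_ifs with h <;> simp [h]
  have e1 := h.path_exposed br hbr hbr1
  have e2 := h.path_of_not_reached br hbr hbr1 bq hbq hbq1
  have hGn : ∀ q ≤ k, G' bq q = if q = bq then k else if q = br then M bq else G br q :=
    fun q hq => by rw [hG' bq (by omega) q (by omega), if_pos rfl, h.root_eq]
  have hGo : ∀ r ≤ k, ∀ q ≤ k, r ≠ bq → G' r q = G r q :=
    fun r hr q hq hrb => by rw [hG' r (by omega) q (by omega), if_neg hrb]
  have hold : ∀ r, R' r = 1 → r ≠ bq → R r = 1 := fun r hr hrb => ((hR r).1 hr).resolve_left hrb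
  refine ⟨h.lt, h.inj, h.root_eq, h.le, h.tight, h.row_le, h.row_eq_zero, (hR k).2 (.inr h.root),
    ?_, ?_, ?_, ?_, ?_, ?_, ?_, ?_, ?_⟩
  · intro r hr hr1
    rcases (hR r).1 hr1 with rfl | hr1
    · exact hbq
    · exact h.reached_le r hr hr1
  · intro r hr hr1 q hq
    by_cases hrb : r = bq
    · rw [hrb, hGn q hq]
      split_ifs
      · exact le_rfl
      · exact h.lt bq hbq
      · exact h.path_lt br hbr hbr1 q hq
    · rw [hGo r hr q hq hrb]
      exact h.path_lt r hr (hold r hr1 hrb) q hq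
  · intro r hr hr1 q hq q' hq'
    by_cases hrb : r = bq
    -- Since `G br br = k` and `G br bq = M bq`, the new matching is `G br` with its values at `br`
    -- and `bq` exchanged. This makes it injective.
    · rw [hrb, hGn q hq, hGn q' hq', ← e1, ← e2]
      have hi := h.path_inj br hbr hbr1
      have i1 := hi q hq q' hq'
      have i2 := hi q hq br hbr
      have i3 := hi q hq bq hbq
      have i4 := hi br hbr q' hq'
      have i5 := hi bq hbq q' hq'
      have i6 := hi bq hbq br hbr
      grind
    · rw [hGo r hr q hq hrb, hGo r hr q' hq' hrb]
      exact h.path_inj r hr (hold r hr1 hrb) q hq q' hq'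
  · intro r hr hr1 q hq hqm
    rw [hG' r (by omega) q hqm]
    split_ifs with hrb
    · omega
    · omega
    · exact h.path_eq_self br hbr hbr1 q hq hqm
    · exact h.path_eq_self r hr (hold r hr1 hrb) q hq hqm
  · intro r hr hr1
    by_cases hrb : r = bq
    · rw [hrb, hGn bq hbq, if_pos rfl]
    · rw [hGo r hr r hr hrb]
      exact h.path_exposed r hr (hold r hr1 hrb)
  · intro r hr hr1 q hq hq1
    have hqb : q ≠ bq := fun h => hq1 ((hR q).2 (.inl h))
    have hq1' : R q ≠ 1 := fun h => hq1 ((hR q).2 (.inr h))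
    by_cases hrb : r = bq
    · rw [hrb, hGn q hq, if_neg hqb, if_neg fun hb : q = br => hq1' (hb ▸ hbr1)]
      exact h.path_of_not_reached br hbr hbr1 q hq hq1'
    · rw [hGo r hr q hq hrb]
      exact h.path_of_not_reached r hr (hold r hr1 hrb) q hq hq1'
  · intro r hr hr1 q hq hqr hq1
    by_cases hrb : r = bq
    · subst hrb
      rw [hGn q hq, if_neg hqr]
      split_ifs with hqb
      · exact ⟨r, hr, hr1, hbk, rfl⟩
      · obtain ⟨q', h1, h2, h3, h4⟩ := h.path_of_reached br hbr hbr1 q hq hqb (hold q hq1 hqr)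
        exact ⟨q', h1, (hR q').2 (.inr h2), h3, h4⟩
    · rw [hGo r hr q hq hrb]
      by_cases hqb : q = bq
      · subst hqb
        exact ⟨q, hq, hq1, hbk, h.path_of_not_reached r hr (hold r hr1 hrb) q hq hbq1⟩
      · obtain ⟨q', h1, h2, h3, h4⟩ :=
          h.path_of_reached r hr (hold r hr1 hrb) q hq hqr (hold q hq1 hqb)
        exact ⟨q', h1, (hR q').2 (.inr h2), h3, h4⟩
  · intro r hr hr1 q hq hqr
    by_cases hrb : r = bq
    · subst hrb
      rw [hGn q hq, if_neg hqr]
      split_ifs with hqb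
      · rw [hqb, ht]
      · exact h.path_tight br hbr hbr1 q hq hqb
    · rw [hGo r hr q hq hrb]
      exact h.path_tight r hr (hold r hr1 hrb) q hq hqr
  · have : ((Finset.range m).filter fun r => R' r = 1) =
        insert bq ((Finset.range m).filter fun r => R r = 1) := by
      ext r
      simp only [Finset.mem_filter, Finset.mem_range, Finset.mem_insert, hR]
      constructor
      · tauto
      · rintro (rfl | h)
        · exact ⟨by omega, .inl rfl⟩
        · exact ⟨h.1, .inr h.2⟩
    rw [this, Finset.card_insert_of_notMem (by simp [hbq1]), h.card]

/-- Bounds the number of times the tree can grow, and so shows that `m` rounds of the search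
suffice. -/
theorem SearchTree.lt_of_card (h : SearchTree c m k i M U V R G S) : i < m := by
  have := Finset.card_filter_le (Finset.range m) fun r => R r = 1
  rw [h.card, Finset.card_range] at this
  omega

/-- A certified matching of all rows and columns has minimum cost. -/
theorem DualCertificate.exists_equiv {n : ℕ} [NeZero n] {I : FairInstance n m}
    (h : DualCertificate c m m M U V S) (hc : ∀ q p : Fin m, c q p = I.cost q p) :
    ∃ μ : Fin m ≃ Fin m, (∀ q : Fin m, (μ q : ℕ) = M q) ∧
      ∀ ν : Fin m ≃ Fin m, ∑ q, I.cost q (μ q) ≤ ∑ q, I.cost q (ν q) := by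
  let f : Fin m → Fin m := fun q => ⟨M q, h.lt q q.2⟩
  have hf : Function.Injective f := fun q r hqr =>
    Fin.ext (h.inj q q.2 r r.2 (congrArg Fin.val hqr))
  let μ := Equiv.ofBijective f (Finite.injective_iff_bijective.1 hf)
  have hμ : ∀ q : Fin m, (μ q : ℕ) = M q := fun q => rfl
  refine ⟨μ, hμ, fun ν => ?_⟩
  -- Weak duality: the sum of the `U q` minus that of the `V p` is a lower bound for the cost of
  -- every matching, and tightness attains it at `μ`.
  have h1 : ∑ q : Fin m, U q = ∑ q, I.cost q (μ q) + ∑ p : Fin m, V p := by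
    rw [← Equiv.sum_comp μ fun p => V p, ← Finset.sum_add_distrib]
    refine Finset.sum_congr rfl fun q _ => ?_
    rw [← hc, hμ]
    exact h.tight q q.2
  have h2 : ∑ q : Fin m, U q ≤ ∑ q, I.cost q (ν q) + ∑ p : Fin m, V p := by
    rw [← Equiv.sum_comp ν fun p => V p, ← Finset.sum_add_distrib]
    refine Finset.sum_le_sum fun q _ => ?_
    rw [← hc]
    exact h.le q q.2 (ν q) (ν q).2
  omega

/-! ### The program

Arrays: `0` output, `1` row offsets, `2` team of each position, `3` scales, `4` cost matrix, `5` and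
`6` dual variables, `7` current matching, `8` matchings of the search tree, `9` reached rows. -/

/-- Equality test. -/
def BExp.eq (e₁ e₂ : NExp) : BExp := .and (.le e₁ e₂) (.le e₂ e₁)

@[simp]
theorem BExp.eval_eq {n m : ℕ} {I : FairInstance n m} {s : Memory} {e₁ e₂ : NExp} :
    (BExp.eq e₁ e₂).eval I s ↔ e₁.eval s = e₂.eval s := by
  simp [BExp.eq, BExp.eval, le_antisymm_iff]

/-- The entry in row `r` and column `e` of matrix `a`. -/
def NExp.cell (a r : ℕ) (e : NExp) : NExp := .get a (.add (.get 1 (.var r)) e)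

/-! ### Computing the tables and the cost matrix -/

namespace Prog

def initTablesStep : Prog :=
  .seq (.store 1 (.var 2) (.var 3)) <| .seq (.store 2 (.var 2) (.var 4)) <|
    .seq (.store 7 (.var 2) (.var 2)) <| .seq (.assign 3 (.add (.var 3) (.var 1))) <|
    .seq (.assign 4 (.add (.var 4) (.lit 1))) <| .ite (.le (.var 0) (.var 4)) (.assign 4 (.lit 0))

/-- Row offsets, teams of the positions, and the initial matching. -/
def initTables : Prog := .rep 2 1 initTablesStep

def initScalesStep : Prog :=
  .seq (.store 3 (.sub (.sub (.var 1) (.lit 1)) (.var 2)) (.var 5)) <|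
    .seq (.assign 6 (.var 5)) <| .rep 7 1 (.assign 5 (.add (.var 5) (.var 6)))

/-- The factors of the ordinal values in the costs. -/
def initScales : Prog :=
  .seq (.assign 5 (.lit 1)) <| .seq (.rep 2 1 (.assign 5 (.add (.var 5) (.var 0)))) <|
    .rep 2 1 initScalesStep

def addOrdinal : Prog :=
  .rep 5 1 <| .ite (.not (.valueLE (.get 2 (.var 2)) (.var 5) (.var 3))) <|
    .assign 4 (.add (.var 4) (.get 3 (.var 2)))

def addRank : Prog :=
  .rep 5 0 <| .ite (.not (.pref (.var 3) (.get 2 (.var 2)) (.var 5))) <|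
    .assign 4 (.add (.var 4) (.lit 1))

def initCostsStep : Prog :=
  .seq (.assign 4 (.lit 1)) <| .seq addOrdinal <| .seq addRank <|
    .store 4 (.add (.get 1 (.var 2)) (.var 3)) (.var 4)

/-- The cost matrix. -/
def initCosts : Prog := .rep 2 1 (.rep 3 1 initCostsStep)

variable {n m : ℕ} {I : FairInstance n m} {s : Memory}

/-- With no multiplication or division available, multiples of `m` are accumulated in variable 3 and
residues modulo `n` come from variable 4, which is reset on reaching `n`. -/
theorem run_initTables (h0 : s.var 0 = n) (h1 : s.var 1 = m) (h3 : s.var 3 = 0)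
    (h4 : s.var 4 = 0) (hn : 0 < n) {q : ℕ} (hq : q < m) :
    (initTables.run I s).arr 1 q = q * m ∧ (initTables.run I s).arr 2 q = q % n ∧
      (initTables.run I s).arr 7 q = q := by
  refine (run_rep_induction (N := m) (c := initTablesStep)
    (fun i t => t.var 3 = i * m ∧ t.var 4 = i % n ∧
      ∀ q < i, t.arr 1 q = q * m ∧ t.arr 2 q = q % n ∧ t.arr 7 q = q) h1
    (by decide) (by simp [h3, h4]) ?_).2.2 q hq
  intro i hi t ht hvar _ ⟨g3, g4, gq⟩
  have e0 := (hvar 0 (by decide) (by decide)).trans h0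
  have e1 := (hvar 1 (by decide) (by decide)).trans h1
  have hmod : (i + 1) % n = if n ≤ i % n + 1 then 0 else i % n + 1 := by
    have := Nat.mod_lt i hn
    rw [← Nat.mod_add_mod]
    split_ifs with hle
    · rw [show i % n + 1 = n by omega, Nat.mod_self]
    · exact Nat.mod_eq_of_lt (by omega)
  have key : ∀ t' : Memory, t'.var 3 = (i + 1) * m →
      t'.var 4 = (i + 1) % n → (∀ a q, t'.arr a q = if q = i then
        (if a = 1 then i * m else if a = 2 then i % n else if a = 7 then i else t.arr a q)
        else t.arr a q) →
      t'.var 3 = (i + 1) * m ∧ t'.var 4 = (i + 1) % n ∧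
        ∀ q < i + 1, t'.arr 1 q = q * m ∧ t'.arr 2 q = q % n ∧ t'.arr 7 q = q := by
    intro t' g3 g4 ga
    refine ⟨g3, g4, fun q hq => ?_⟩
    rw [ga, ga, ga]
    by_cases hqi : q = i
    · simp [hqi]
    · simpa [hqi] using gq q (by omega)
  apply key
  · by_cases hle : n ≤ i % n + 1 <;>
      simp [initTablesStep, run, NExp.eval, BExp.eval, *, Nat.succ_mul]
  · by_cases hle : n ≤ i % n + 1 <;> simp [initTablesStep, run, NExp.eval, BExp.eval, *]
  · intro a q
    have : ∀ (b : BExp) x e t, (run I (.ite b (.assign x e)) t).arr = t.arr := by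
      intro b x e t
      rw [run]
      split_ifs <;> rfl
    simp only [initTablesStep, run_seq, Memory.setVar_arr, this, run_assign, run_store]
    simp only [Memory.setArr, NExp.eval, Function.update_apply, ht, g3, g4]
    grind [Function.update_apply]

/-- Adding `m` copies of a number to itself multiplies it by `m + 1`. The table is filled from the
last position backwards, so that round `i` writes the factor with exponent `i`. -/
theorem run_initScales (h0 : s.var 0 = n) (h1 : s.var 1 = m) {q : ℕ} (hq : q < m) :
    (initScales.run I s).arr 3 q = (n * m + 1) * (m + 1) ^ (m - 1 - q) := by
  rw [initScales, run_seq, run_seq]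
  set s1 := run I (.rep 2 1 (.assign 5 (.add (.var 5) (.var 0)))) (run I (.assign 5 (.lit 1)) s)
    with hs1
  have e5 : s1.var 5 = n * m + 1 := by
    rw [hs1, run_rep_add (by decide) (by decide) (by decide)]
    simp [NExp.eval, h0, h1]
    ring
  have e1 : s1.var 1 = m := by
    rw [hs1, run_var (by decide), run_var (by decide), h1]
  refine (run_rep_induction (N := m) (c := initScalesStep)
    (fun i t => t.var 5 = (n * m + 1) * (m + 1) ^ i ∧
      ∀ q < m, m - 1 - q < i → t.arr 3 q = (n * m + 1) * (m + 1) ^ (m - 1 - q)) e1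
    (by decide) (by simp [e5]) ?_).2 q hq (by omega)
  intro i hi t ht hvar _ ⟨g5, gq⟩
  have g1 := (hvar 1 (by decide) (by decide)).trans e1
  constructor
  · rw [initScalesStep, run_seq, run_seq, Memory.setVar_var_of_ne _ _ (by decide),
      run_rep_add (by decide) (by decide) (by decide)]
    simp [NExp.eval, g1, g5]
    ring
  · intro q hq hlt
    rw [initScalesStep, run_seq, Memory.setVar_arr, run_arr (by decide)]
    simp only [run_store, NExp.eval, Memory.setArr_arr_self, g1, ht, g5, Function.update_apply]
    split_ifs with hqi
    · rw [hqi]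
      congr 2
      omega
    · exact gq q hq (by omega)

/-- The negated query expresses a strictly larger value because all its indices are in range; an
index out of range would make the negation true. -/
theorem run_addOrdinal [NeZero n] (h1 : s.var 1 = m) {q p : Fin m} (h2 : s.var 2 = q)
    (h3 : s.var 3 = p) (ht : s.arr 2 q = q % n) :
    (addOrdinal.run I s).var 4 = s.var 4 + s.arr 3 q * I.ordinal q p := by
  classical
  have hn : (q : ℕ) % n < n := Nat.mod_lt _ (Nat.pos_of_ne_zero (NeZero.ne n))
  rw [addOrdinal, run_rep_count (fun x => I.weight q p < I.weight q x) h1 (by decide)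
    (w := s.arr 3 q), FairInstance.ordinal]
  intro i t h5 hvar harr
  have e2 := (hvar 2 (by decide) (by decide)).trans h2
  have e3 := (hvar 3 (by decide) (by decide)).trans h3
  refine ⟨?_, by simp [NExp.eval, harr, e2]⟩
  simp only [BExp.eval, NExp.eval, e2, e3, h5, harr, ht, ← not_le (b := I.weight q p)]
  exact not_congr ⟨fun ⟨_, _, _, h⟩ => h, fun h => ⟨hn, i.2, p.2, h⟩⟩

/-- By totality, the negated query is strict preference. The loop counts only the preferred teams;
the remaining 1 in the rank is the initial value of variable 4 in `initCostsStep`, hence the form of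
the equation. -/
theorem run_addRank (h0 : s.var 0 = n) {p : Fin m} {q : ℕ} {j : Fin n} (h2 : s.var 2 = q)
    (h3 : s.var 3 = p) (ht : s.arr 2 q = j) :
    (addRank.run I s).var 4 + 1 = s.var 4 + I.rank p j := by
  classical
  rw [addRank, run_rep_count (fun x => I.StrictPref p x j) h0 (by decide) (w := 1),
    FairInstance.rank]
  · ring
  intro i t h5 hvar harr
  have e2 := (hvar 2 (by decide) (by decide)).trans h2
  have e3 := (hvar 3 (by decide) (by decide)).trans h3
  refine ⟨?_, rfl⟩
  simp only [BExp.eval, NExp.eval, e2, e3, h5, harr, ht]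
  constructor
  · intro h
    have h' : ¬ I.pref p j i := fun h' => h ⟨p.2, j.2, i.2, h'⟩
    exact ⟨(I.pref_total p _ _).resolve_right h', h'⟩
  · rintro h ⟨_, _, _, h'⟩
    exact h.2 h'

theorem cell_eq_iff {q q' p p' : ℕ} (hp : p < m) (hp' : p' < m) :
    q * m + p = q' * m + p' ↔ q = q' ∧ p = p' := by
  refine ⟨fun h => ?_, by rintro ⟨rfl, rfl⟩; rfl⟩
  have h1 := congrArg (· / m) h
  have h2 := congrArg (· % m) h
  have hm : 0 < m := by omega
  simpa [mul_comm _ m, Nat.mul_add_div hm, Nat.mul_add_mod, Nat.div_eq_of_lt, Nat.mod_eq_of_lt,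
    hp, hp'] using And.intro h1 h2

theorem run_initCostsStep [NeZero n] (h0 : s.var 0 = n) (h1 : s.var 1 = m) {q p : Fin m}
    (h2 : s.var 2 = q) (h3 : s.var 3 = p) (hb : s.arr 1 q = q * m) (ht : s.arr 2 q = q % n)
    (hs : s.arr 3 q = (n * m + 1) * (m + 1) ^ (m - 1 - (q : ℕ))) :
    (initCostsStep.run I s).arr 4 = Function.update (s.arr 4) (q * m + p) (I.cost q p) := by
  have e1 := run_addOrdinal (I := I) (s := s.setVar 4 1) (by simpa) (by simpa) (by simpa) ht
  have ev : ∀ y, y ≠ 4 → y ≠ 5 → (run I addOrdinal (s.setVar 4 1)).var y = s.var y :=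
    fun y h4 h5 => (run_var (by simp [addOrdinal, vars, h4, h5])).trans (by simp [h4])
  have ea : (run I addOrdinal (s.setVar 4 1)).arr = s.arr :=
    funext fun a => run_arr (by simp [addOrdinal, arrs])
  have e2 := run_addRank (I := I) (s := addOrdinal.run I (s.setVar 4 1)) (p := p)
    (j := positionTeam q) ((ev 0 (by decide) (by decide)).trans h0)
    ((ev 2 (by decide) (by decide)).trans h2) ((ev 3 (by decide) (by decide)).trans h3)
    (by rw [ea, ht]; rfl)
  rw [e1, Memory.setVar_var_self, Memory.setVar_arr, hs] at e2
  have ev' : ∀ y, y ≠ 4 → y ≠ 5 →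
      (run I addRank (run I addOrdinal (s.setVar 4 1))).var y = s.var y :=
    fun y h4 h5 => (run_var (by simp [addRank, vars, h4, h5])).trans (ev y h4 h5)
  have ea' : (run I addRank (run I addOrdinal (s.setVar 4 1))).arr = s.arr :=
    (funext fun a => run_arr (by simp [addRank, arrs])).trans ea
  simp only [initCostsStep, run_seq, run_assign, run_store, NExp.eval, Memory.setArr_arr_self, ea',
    ev' 2 (by decide) (by decide), ev' 3 (by decide) (by decide), h2, h3, hb]
  congr 1
  unfold FairInstance.cost
  omega

theorem run_initCosts [NeZero n] (h0 : s.var 0 = n) (h1 : s.var 1 = m)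
    (hb : ∀ q < m, s.arr 1 q = q * m) (ht : ∀ q < m, s.arr 2 q = q % n)
    (hs : ∀ q < m, s.arr 3 q = (n * m + 1) * (m + 1) ^ (m - 1 - q)) (q p : Fin m) :
    (initCosts.run I s).arr 4 (q * m + p) = I.cost q p := by
  refine run_rep_induction (N := m) (c := .rep 3 1 initCostsStep)
    (fun i t => ∀ q p : Fin m, (q : ℕ) < i → t.arr 4 (q * m + p) = I.cost q p) h1
    (by decide) (by simp) ?_ q p q.2
  intro i hi t h2 hvar harr hP
  rw [Memory.setVar_arr]
  have e0 := (hvar 0 (by decide) (by decide)).trans h0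
  have e1 := (hvar 1 (by decide) (by decide)).trans h1
  have main := run_rep_induction (I := I) (s := t) (x := 3) (N := m) (c := initCostsStep)
    (fun j t' => ∀ q p : Fin m, ((q : ℕ) < i ∨ (q : ℕ) = i ∧ (p : ℕ) < j) →
      t'.arr 4 (q * m + p) = I.cost q p) e1
    (by decide) (by simpa using hP) (by
    intro j hj t' h3 hvar' harr' hP' q p hqp
    rw [Memory.setVar_arr, run_initCostsStep (q := ⟨i, hi⟩) (p := ⟨j, hj⟩)
      ((hvar' 0 (by decide) (by decide)).trans e0) ((hvar' 1 (by decide) (by decide)).trans e1)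
      ((hvar' 2 (by decide) (by decide)).trans h2) h3
      (by rw [harr' 1 (by decide), harr 1 (by decide)]; exact hb i hi)
      (by rw [harr' 2 (by decide), harr 2 (by decide)]; exact ht i hi)
      (by rw [harr' 3 (by decide), harr 3 (by decide)]; exact hs i hi), Function.update_apply]
    simp only [cell_eq_iff p.2 hj]
    split_ifs with h
    · congr 1 <;> ext <;> simp [h]
    · exact hP' q p (by omega))
  intro q p hq
  exact main q p (by have := p.2; omega)

end Prog

/-- The slack of the dual constraint of row `r` and the column matched to row `q`. -/
def NExp.slack (r q : ℕ) : NExp :=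
  .sub (.add (.cell 4 r (.get 7 (.var q))) (.get 6 (.get 7 (.var q)))) (.get 5 (.var r))

/-- Row `10` is reached and the column of row `11` is not. -/
def BExp.candidate : BExp :=
  .and (.eq (.get 9 (.var 10)) (.lit 1)) <| .and (.le (.var 11) (.var 2)) <|
    .not (.and (.eq (.get 9 (.var 11)) (.lit 1)) (.not (.eq (.var 11) (.var 2))))

/-! ### The Hungarian method on the machine -/

namespace Memory

variable (s : Memory) (m : ℕ)

/-- Truncation is harmless while the dual constraints hold. -/
def slack (r q : ℕ) : ℕ := s.arr 4 (r * m + s.arr 7 q) + s.arr 6 (s.arr 7 q) - s.arr 5 r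

/-- Row `q` stands for its column. Row `k`, kept in variable 2, is reached, but its column is the
exposed one and remains a target. -/
def Candidate (r q : ℕ) : Prop := s.arr 9 r = 1 ∧ q ≤ s.var 2 ∧ ¬ (s.arr 9 q = 1 ∧ q ≠ s.var 2)

/-- The memory holds a search tree for row `k` with `i + 1` rows. -/
def Searching (k i : ℕ) : Prop :=
  SearchTree (fun q p => s.arr 4 (q * m + p)) m k i (s.arr 7) (s.arr 5) (s.arr 6) (s.arr 9)
    (fun r q => s.arr 8 (r * m + q)) (s.var 3)

/-- The memory holds an optimal matching of the first `k` rows and columns. -/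
def Certified (k : ℕ) : Prop :=
  DualCertificate (fun q p => s.arr 4 (q * m + p)) m k (s.arr 7) (s.arr 5) (s.arr 6) (s.var 3)

end Memory

namespace Prog

def findMinStep : Prog :=
  .ite (.and .candidate (.not (.le (.var 9) (.slack 10 11)))) <|
    .seq (.assign 7 (.var 10)) <| .seq (.assign 8 (.var 11)) (.assign 9 (.slack 10 11))

/-- A candidate edge of minimum slack. -/
def findMin : Prog :=
  .seq (.assign 7 (.var 2)) <| .seq (.assign 8 (.var 2)) <| .seq (.assign 9 (.slack 2 2)) <|
    .rep 10 1 (.rep 11 1 findMinStep)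

def raiseStep : Prog :=
  .ite (.eq (.get 9 (.var 10)) (.lit 1)) <|
    .seq (.store 5 (.var 10) (.add (.get 5 (.var 10)) (.var 9))) <|
    .ite (.not (.eq (.var 10) (.var 2))) <|
      .store 6 (.get 7 (.var 10)) (.add (.get 6 (.get 7 (.var 10))) (.var 9))

/-- Raising the dual variables of the tree by the minimum slack. -/
def raise : Prog := .seq (.rep 10 1 raiseStep) (.assign 3 (.add (.var 3) (.var 9)))

/-- Replacing the matching if the exposed column is reached. -/
def augment : Prog :=
  .ite (.eq (.var 8) (.var 2)) <| .seq (.assign 5 (.lit 1)) <|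
    .rep 10 1 (.store 7 (.var 10) (.cell 8 7 (.var 10)))

/-- Extending the tree if another column is reached. -/
def grow : Prog :=
  .ite (.not (.eq (.var 8) (.var 2))) <| .seq (.store 9 (.var 8) (.lit 1)) <|
    .seq (.rep 10 1 (.store 8 (.add (.get 1 (.var 8)) (.var 10)) (.cell 8 7 (.var 10)))) <|
    .seq (.store 8 (.add (.get 1 (.var 8)) (.var 7)) (.get 7 (.var 8))) <|
      .store 8 (.add (.get 1 (.var 8)) (.var 8)) (.get 7 (.var 2))

def searchStep : Prog := .seq findMin <| .seq raise <| .seq augment grow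

def initSearch : Prog :=
  .seq (.store 6 (.var 2) (.var 3)) <| .seq (.rep 4 1 (.store 9 (.var 4) (.lit 0))) <|
    .seq (.store 9 (.var 2) (.lit 1)) <|
    .seq (.rep 4 1 (.store 8 (.add (.get 1 (.var 2)) (.var 4)) (.get 7 (.var 4))))
      (.assign 5 (.lit 0))

/-- Adding one row and column to the matching. -/
def search : Prog := .seq initSearch <| .rep 6 1 (.ite (.eq (.var 5) (.lit 0)) searchStep)

/-- The two phases of the algorithm. -/
def main : Prog :=
  .seq initTables <| .seq initScales <| .seq initCosts <| .seq (.rep 2 1 search) <|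
    .rep 2 1 (.store 0 (.get 7 (.var 2)) (.get 2 (.var 2)))

theorem main_wellFormed : main.WellFormed := by
  simp [main, WellFormed, vars, initTables, initTablesStep, initScales, initScalesStep, initCosts,
    initCostsStep, addOrdinal, addRank, search, initSearch, searchStep, findMin, findMinStep,
    raise, raiseStep, augment, grow]

variable {n m : ℕ} {I : FairInstance n m} {s : Memory}

/-- The root is reached and its column is always a target, so the pair of variable 2 with itself is
a valid starting value for the minimum. -/
theorem run_findMin (h1 : s.var 1 = m) (hb : ∀ q < m, s.arr 1 q = q * m) (hk : s.var 2 < m)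
    (hR : s.arr 9 (s.var 2) = 1) :
    (findMin.run I s).var 7 < m ∧
    s.Candidate ((findMin.run I s).var 7) ((findMin.run I s).var 8) ∧
    (findMin.run I s).var 9 = s.slack m ((findMin.run I s).var 7) ((findMin.run I s).var 8) ∧
    ∀ r < m, ∀ q < m, s.Candidate r q → (findMin.run I s).var 9 ≤ s.slack m r q := by
  let Best : Memory → Prop := fun t => t.var 7 < m ∧ s.Candidate (t.var 7) (t.var 8) ∧
    t.var 9 = s.slack m (t.var 7) (t.var 8)
  suffices h : Best (findMin.run I s) ∧
      ∀ r < m, ∀ q < m, s.Candidate r q → (findMin.run I s).var 9 ≤ s.slack m r q from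
    ⟨h.1.1, h.1.2.1, h.1.2.2, h.2⟩
  rw [findMin, run_seq, run_seq, run_seq]
  set s1 := run I (.assign 9 (.slack 2 2)) (run I (.assign 8 (.var 2))
    (run I (.assign 7 (.var 2)) s)) with hs1
  have e1 : s1.var 1 = m := by simp [hs1, h1]
  have e2 : s1.var 2 = s.var 2 := by simp [hs1]
  have ea : s1.arr = s.arr := rfl
  have hbest : Best s1 := by
    simp [Best, hs1, NExp.eval, NExp.slack, NExp.cell, hk, hb _ hk, Memory.slack,
      Memory.Candidate, hR]
  refine run_rep_induction (N := m) (c := .rep 11 1 findMinStep)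
    (fun i t => Best t ∧ ∀ r < i, ∀ q < m, s.Candidate r q → t.var 9 ≤ s.slack m r q) e1
    (by decide) ⟨by simpa [Best] using hbest, by simp⟩ ?_
  intro i hi t h10 hvar harr ⟨hP1, hP2⟩
  have f1 := (hvar 1 (by decide) (by decide)).trans e1
  have f2 := (hvar 2 (by decide) (by decide)).trans e2
  have fa : t.arr = s.arr := (funext fun a => harr a (by simp [arrs, findMinStep])).trans ea
  -- The pairs inspected so far form an initial segment of the lexicographic order.
  have inner := run_rep_induction (I := I) (s := t) (x := 11) (N := m) (c := findMinStep)
    (fun j t' => Best t' ∧ ∀ r q, (r < i ∨ r = i ∧ q < j) → q < m → s.Candidate r q →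
      t'.var 9 ≤ s.slack m r q) f1 (by decide)
    ⟨by simpa [Best] using hP1, fun r q hr hq => by
      simpa using hP2 r (by omega) q hq⟩ (by
    intro j hj t' h11 hvar' harr' ⟨hQ1, hQ2⟩
    have g10 := (hvar' 10 (by decide) (by decide)).trans h10
    have g2 := (hvar' 2 (by decide) (by decide)).trans f2
    have ga : t'.arr = s.arr := (funext fun a => harr' a (by simp [arrs, findMinStep])).trans fa
    have hc : BExp.candidate.eval I t' ↔ s.Candidate i j := by
      simp only [BExp.candidate, BExp.eval, BExp.eval_eq, NExp.eval, g10, g2, ga, h11,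
        Memory.Candidate, ne_eq]
    have hs : (NExp.slack 10 11).eval t' = s.slack m i j := by
      simp [NExp.slack, NExp.cell, NExp.eval, g10, ga, h11, Memory.slack, hb i hi]
    by_cases hlt : s.Candidate i j ∧ s.slack m i j < t'.var 9
    · have hcond : (BExp.and .candidate (.not (.le (.var 9) (.slack 10 11)))).eval I t' := by
        simpa only [BExp.eval, hc, hs, NExp.eval, not_le] using hlt
      have hs' : (NExp.slack 10 11).eval ((t'.setVar 7 i).setVar 8 j) = s.slack m i j := by
        simp [NExp.slack, NExp.cell, NExp.eval, g10, ga, h11, Memory.slack, hb i hi]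
      rw [findMinStep, run_ite_of_true hcond]
      refine ⟨by simp [Best, NExp.eval, g10, h11, hi, hlt.1, hs'], fun r q hr hq hcand => ?_⟩
      have : r < i ∨ r = i ∧ q < j ∨ r = i ∧ q = j := by omega
      simp only [run_seq, run_assign, NExp.eval, g10, h11, Memory.setVar_var_of_ne, ne_eq,
 Nat.reduceEqDiff, not_false_eq_true, Memory.setVar_var_self, hs']
      rcases this with h | h | ⟨rfl, rfl⟩
      · exact hlt.2.le.trans (hQ2 r q (.inl h) hq hcand)
      · exact hlt.2.le.trans (hQ2 r q (.inr h) hq hcand)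
      · exact le_rfl
    · have hcond : ¬ (BExp.and .candidate (.not (.le (.var 9) (.slack 10 11)))).eval I t' := by
        simpa only [BExp.eval, hc, hs, NExp.eval, not_le] using hlt
      rw [findMinStep, run_ite_of_false hcond]
      refine ⟨by simpa [Best] using hQ1, fun r q hr hq hcand => ?_⟩
      rw [Memory.setVar_var_of_ne _ _ (by decide)]
      have : r < i ∨ r = i ∧ q < j ∨ r = i ∧ q = j := by omega
      rcases this with h | h | ⟨rfl, rfl⟩
      · exact hQ2 r q (.inl h) hq hcand
      · exact hQ2 r q (.inr h) hq hcand
      · exact not_lt.1 fun h => hlt ⟨hcand, h⟩)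
  refine ⟨by simpa [Best] using inner.1, fun r hr q hq hc => ?_⟩
  rw [Memory.setVar_var_of_ne _ _ (by decide)]
  exact inner.2 r q (by omega) hq hc

/-- Injectivity of the matching ensures that no column is raised twice. The column of the root is
left alone because it is exposed. -/
theorem run_raise (h1 : s.var 1 = m) (hk : s.var 2 < m)
    (hinj : ∀ q ≤ s.var 2, ∀ r ≤ s.var 2, s.arr 7 q = s.arr 7 r → q = r)
    (hR : ∀ r < m, s.arr 9 r = 1 → r ≤ s.var 2) :
    (∀ r < m, (raise.run I s).arr 5 r = s.arr 5 r + if s.arr 9 r = 1 then s.var 9 else 0) ∧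
    (∀ r ≤ s.var 2, (raise.run I s).arr 6 (s.arr 7 r) = s.arr 6 (s.arr 7 r) +
      if s.arr 9 r = 1 ∧ r ≠ s.var 2 then s.var 9 else 0) ∧
    (raise.run I s).var 3 = s.var 3 + s.var 9 := by
  have main := run_rep_induction (I := I) (s := s) (x := 10) (N := m) (c := raiseStep)
    (fun i t => (∀ r < m, t.arr 5 r = s.arr 5 r + if r < i ∧ s.arr 9 r = 1 then s.var 9 else 0) ∧
      ∀ r ≤ s.var 2, t.arr 6 (s.arr 7 r) = s.arr 6 (s.arr 7 r) +
        if r < i ∧ s.arr 9 r = 1 ∧ r ≠ s.var 2 then s.var 9 else 0) h1 (by decide) (by simp) (by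
    intro i hi t h10 hvar harr ⟨hU, hV⟩
    have e2 := hvar 2 (by decide) (by decide)
    have e9 := hvar 9 (by decide) (by decide)
    have a7 := harr 7 (by decide)
    have a9 := harr 9 (by decide)
    have hlt : ∀ r, r < i + 1 ↔ r < i ∨ r = i := fun r => by omega
    by_cases hc : s.arr 9 i = 1
    · have hik := hR i hi hc
      rw [raiseStep, run_ite_of_true (by simpa [NExp.eval, h10, a9] using hc), run_seq]
      by_cases hc' : i = s.var 2
      · rw [run_ite_of_false (by simpa [BExp.eval, NExp.eval, h10, e2] using hc')]
        refine ⟨fun r hr => ?_, fun r hr => ?_⟩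
        · have := hU r hr
          simp only [run_store, Memory.setVar_arr, Memory.setArr_arr_self, NExp.eval, h10, e9,
            Function.update_apply]
          by_cases hri : r = i
          · subst hri
            simp [this, hc]
          · simp [this, hlt, hri]
        · have := hV r hr
          simp only [run_store, Memory.setVar_arr, ne_eq, Nat.reduceEqDiff,
            not_false_eq_true, Memory.setArr_arr_of_ne, this, hlt]
          by_cases hri : r = i
          · simp [hri, hc']
          · simp [hri]
      · rw [run_ite_of_true (by simpa [BExp.eval, NExp.eval, h10, e2] using hc')]
        refine ⟨fun r hr => ?_, fun r hr => ?_⟩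
        · have := hU r hr
          simp only [run_store, Memory.setVar_arr, Memory.setArr_arr_self, NExp.eval, h10, e9,
            Function.update_apply, ne_eq, Nat.reduceEqDiff,
            not_false_eq_true, Memory.setArr_arr_of_ne]
          by_cases hri : r = i
          · subst hri
            simp [this, hc]
          · simp [this, hlt, hri]
        · have := hV r hr
          have hVi := hV i hik
          simp only [run_store, Memory.setVar_arr, Memory.setArr_var, Memory.setArr_arr_self,
            NExp.eval, h10, e9, a7,
            Function.update_apply, ne_eq, Nat.reduceEqDiff,
            not_false_eq_true, Memory.setArr_arr_of_ne]
          by_cases hri : r = i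
          · subst hri
            simp [this, hc, hc']
          · rw [if_neg fun h => hri (hinj r hr i hik h)]
            simp [this, hlt, hri]
    · rw [raiseStep, run_ite_of_false (by simpa [NExp.eval, h10, a9] using hc)]
      refine ⟨fun r hr => ?_, fun r hr => ?_⟩
      · have := hU r hr
        by_cases hri : r = i
        · subst hri
          simp [this, hc]
        · simp [this, hlt, hri]
      · have := hV r hr
        by_cases hri : r = i
        · subst hri
          simp [this, hc]
        · simp [this, hlt, hri])
  rw [raise, run_seq, run_assign, Memory.setVar_arr, Memory.setVar_var_self]
  refine ⟨fun r hr => ?_, fun r hr => ?_, ?_⟩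
  · simpa [hr] using main.1 r hr
  · simpa [hr.trans_lt hk] using main.2 r hr
  · simp only [NExp.eval]
    rw [run_var (by decide), run_var (by decide)]

theorem run_augment_of_ne (h : s.var 8 ≠ s.var 2) : augment.run I s = s :=
  run_ite_of_false (by simpa [NExp.eval] using h) _

theorem run_augment (h1 : s.var 1 = m) (hb : ∀ q < m, s.arr 1 q = q * m) (h7 : s.var 7 < m)
    (h : s.var 8 = s.var 2) :
    (augment.run I s).var 5 = 1 ∧
      ∀ q < m, (augment.run I s).arr 7 q = s.arr 8 (s.var 7 * m + q) := by
  rw [augment, run_ite_of_true (by simpa [NExp.eval] using h), run_seq]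
  refine ⟨(run_var (by decide)).trans (by simp [NExp.eval]), ?_⟩
  refine (run_rep_store (fun q => q) (fun q => s.arr 8 (s.var 7 * m + q)) (by simpa)
    (fun _ _ _ _ h => h) ?_).1
  intro q hq t h10 hvar harr _
  have e7 := hvar 7 (by decide)
  have a1 := harr 1 (by decide)
  have a8 := harr 8 (by decide)
  simp only [run_assign, Memory.setVar_arr, ne_eq, Nat.reduceEqDiff, not_false_eq_true,
    Memory.setVar_var_of_ne] at e7 a1 a8
  simp [NExp.eval, NExp.cell, h10, e7, a1, a8, hb _ h7]

theorem run_grow_of_eq (h : s.var 8 = s.var 2) : grow.run I s = s :=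
  run_ite_of_false (by simpa [NExp.eval, BExp.eval] using h) _

/-- A row of the matrix of matchings is copied and two of its entries are overwritten. As `br ≠ bq`,
held in variables 7 and 8, the copy never reads a cell that it has written. -/
theorem run_grow (h1 : s.var 1 = m) (hb : ∀ q < m, s.arr 1 q = q * m) (h7 : s.var 7 < m)
    (h8 : s.var 8 < m) (h78 : s.var 7 ≠ s.var 8) (h : s.var 8 ≠ s.var 2) :
    (∀ r, (grow.run I s).arr 9 r = if r = s.var 8 then 1 else s.arr 9 r) ∧
    ∀ r < m, ∀ q < m, (grow.run I s).arr 8 (r * m + q) = if r = s.var 8 then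
      (if q = s.var 8 then s.arr 7 (s.var 2) else if q = s.var 7 then s.arr 7 (s.var 8)
        else s.arr 8 (s.var 7 * m + q)) else s.arr 8 (r * m + q) := by
  rw [grow, run_ite_of_true (by simpa [NExp.eval, BExp.eval] using h), run_seq, run_seq]
  set s1 := run I (.store 9 (.var 8) (.lit 1)) s with hs1
  have a9 : ∀ r, s1.arr 9 r = if r = s.var 8 then 1 else s.arr 9 r := fun r => by
    simp [hs1, NExp.eval, Function.update_apply]
  obtain ⟨c1, c2⟩ := run_rep_store (I := I) (s := s1) (x := 10) (b := 1) (N := m) (a := 8)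
    (e₁ := .add (.get 1 (.var 8)) (.var 10)) (e₂ := .cell 8 7 (.var 10))
    (fun q => s.var 8 * m + q) (fun q => s.arr 8 (s.var 7 * m + q)) (by simpa [hs1])
    (fun i hi j hj h => ((cell_eq_iff hi hj).1 h).2) (by
    intro i hi t h10 hvar harr hold
    have e7 := hvar 7 (by decide)
    have e8 := hvar 8 (by decide)
    have a1 := harr 1 (by decide)
    have a8 := hold (s.var 7 * m + i) fun j hj he => h78 ((cell_eq_iff hi hj).1 he).1
    simp only [hs1, run_store, Memory.setArr_var, ne_eq, Nat.reduceEqDiff, not_false_eq_true,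
      Memory.setArr_arr_of_ne] at e7 e8 a1 a8
    simp [NExp.eval, NExp.cell, h10, e7, e8, a1, a8, hb _ h7, hb _ h8])
  set s2 := run I (.rep 10 1 (.store 8 (.add (.get 1 (.var 8)) (.var 10)) (.cell 8 7 (.var 10))))
    s1 with hs2
  have v : ∀ y, y ≠ 10 → s2.var y = s.var y := fun y hy => by
    rw [hs2, run_var (by simpa [vars] using hy)]
    rfl
  have a : ∀ b, b ≠ 8 → s2.arr b = s1.arr b := fun b hy => by
    rw [hs2, run_arr (by simpa [arrs] using hy)]
  have a1 : s2.arr 1 = s.arr 1 := a 1 (by decide)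
  have a7 : s2.arr 7 = s.arr 7 := a 7 (by decide)
  have v2 := v 2 (by decide)
  have v7 := v 7 (by decide)
  have v8 := v 8 (by decide)
  refine ⟨fun r => ?_, fun r hr q hq => ?_⟩
  · rw [← a9, ← a 9 (by decide)]
    simp
  · simp only [run_seq, run_store, NExp.eval, Memory.setArr_var, Memory.setArr_arr_self, ne_eq,
      Nat.reduceEqDiff, not_false_eq_true, Memory.setArr_arr_of_ne, v2, v7, v8, a1, a7,
      hb _ h8, Function.update_apply, cell_eq_iff hq h8, cell_eq_iff hq h7]
    by_cases hr8 : r = s.var 8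
    · subst hr8
      simp only [true_and, if_true]
      split_ifs
      · rfl
      · rfl
      · exact c1 q hq
    · simp only [hr8, false_and, if_false]
      exact c2 _ fun i hi he => hr8 ((cell_eq_iff hq hi).1 he).1

/-- After the raise, the chosen edge of minimum slack is tight. Whether its column is the exposed
one decides between `augment` and `grow`, and variable 5 records the outcome. -/
theorem run_searchStep {k i : ℕ} (h1 : s.var 1 = m) (h2 : s.var 2 = k) (hk : k < m)
    (h5 : s.var 5 = 0) (hb : ∀ q < m, s.arr 1 q = q * m) (hs : s.Searching m k i) :
    (searchStep.run I s).var 5 = 0 ∧ (searchStep.run I s).Searching m k (i + 1) ∨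
      (searchStep.run I s).var 5 = 1 ∧ (searchStep.run I s).Certified m (k + 1) := by
  subst h2
  obtain ⟨m7, m8, m9, hmin⟩ := run_findMin (I := I) h1 hb hk hs.root
  rw [searchStep, run_seq, run_seq, run_seq]
  set s1 := run I findMin s with hs1
  have a1 : s1.arr = s.arr := funext fun a => run_arr (by simp [findMin, findMinStep, arrs])
  have v1 : ∀ y, y < 7 → s1.var y = s.var y := fun y hy =>
    run_var (by simp [findMin, findMinStep, vars]; omega)
  obtain ⟨r1, r2, r3⟩ := run_raise (I := I) (s := s1) ((v1 1 (by decide)).trans h1)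
    (by rwa [v1 2 (by decide)]) (by rw [v1 2 (by decide), a1]; exact hs.inj)
    (by rw [v1 2 (by decide), a1]; exact hs.reached_le)
  rw [v1 2 (by decide), a1] at r2
  rw [a1] at r1
  rw [v1 3 (by decide)] at r3
  set s2 := run I raise s1 with hs2
  have a2 : ∀ a, a ≠ 5 → a ≠ 6 → s2.arr a = s.arr a := fun a h5 h6 =>
    (run_arr (by simp [raise, raiseStep, arrs, h5, h6])).trans (congrFun a1 a)
  have v2 : ∀ y, y ≠ 3 → y ≠ 10 → s2.var y = s1.var y := fun y h h' =>
    run_var (by simp [raise, raiseStep, vars, h, h'])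
  set br := s1.var 7
  set bq := s1.var 8
  set δ := s1.var 9
  obtain ⟨b1, b2, b3⟩ := m8
  have hbr : br ≤ s.var 2 := hs.reached_le br m7 b1
  have b3' : s.arr 9 bq ≠ 1 ∨ bq = s.var 2 := by tauto
  -- Dual feasibility makes the truncated subtraction exact.
  have hslack : ∀ r ≤ s.var 2, ∀ q ≤ s.var 2, s.arr 5 r + s.slack m r q =
      s.arr 4 (r * m + s.arr 7 q) + s.arr 6 (s.arr 7 q) := fun r hr q hq => by
    have := hs.le r hr (s.arr 7 q) (hs.lt q hq)
    unfold Memory.slack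
    omega
  have tree : SearchTree (fun q p => s.arr 4 (q * m + p)) m (s.var 2) i (s.arr 7) (s2.arr 5)
      (s2.arr 6) (s.arr 9) (fun r q => s.arr 8 (r * m + q)) (s.var 3 + δ) := by
    refine SearchTree.raise hs hk (fun r hr hr1 q hq hq1 => ?_) r1 r2
    rw [← hslack r hr q hq]
    exact Nat.add_le_add_left (hmin r (by omega) q (by omega) ⟨hr1, hq, by tauto⟩) _
  have htight : s2.arr 5 br = s.arr 4 (br * m + s.arr 7 bq) + s2.arr 6 (s.arr 7 bq) := by
    rw [r1 br m7, r2 bq b2, if_pos b1, if_neg b3, add_zero, ← hslack br hbr bq b2, m9]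
  have e1 := (v2 1 (by decide) (by decide)).trans ((v1 1 (by decide)).trans h1)
  have e2 := (v2 2 (by decide) (by decide)).trans (v1 2 (by decide))
  have e7 := v2 7 (by decide) (by decide)
  have e8 := v2 8 (by decide) (by decide)
  have hb2 : ∀ q < m, s2.arr 1 q = q * m := by rwa [a2 1 (by decide) (by decide)]
  by_cases hbk : bq = s.var 2
  · right
    obtain ⟨g1, g2⟩ := run_augment (I := I) (s := s2) e1 hb2 (e7.trans_lt m7)
      (e8.trans (hbk.trans e2.symm))
    have hv : ∀ y, y ≠ 5 → y ≠ 10 → (run I augment s2).var y = s2.var y := fun y h h' =>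
      run_var (by simp [augment, vars, h, h'])
    have ha : ∀ a, a ≠ 7 → (run I augment s2).arr a = s2.arr a := fun y h =>
      run_arr (by simp [augment, arrs, h])
    rw [run_grow_of_eq (by
      rw [hv 8 (by decide) (by decide), hv 2 (by decide) (by decide), e8, e2]
      exact hbk)]
    refine ⟨g1, ?_⟩
    unfold Memory.Certified
    rw [ha 4 (by decide), ha 5 (by decide), ha 6 (by decide), hv 3 (by decide) (by decide), r3,
      a2 4 (by decide) (by decide)]
    rw [hbk] at htight
    refine tree.augment hk hbr b1 htight fun q hq => ?_
    rw [g2 q hq, e7, a2 8 (by decide) (by decide)]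
  · left
    have hbq1 := b3'.resolve_right hbk
    have hne : br ≠ bq := fun h => hbq1 (h ▸ b1)
    rw [run_augment_of_ne (by rw [e8, e2]; exact hbk)]
    obtain ⟨g1, g2⟩ := run_grow (I := I) (s := s2) e1 hb2 (by rwa [e7])
      (by rw [e8]; omega) (by rwa [e7, e8]) (by rw [e8, e2]; exact hbk)
    have hv : ∀ y, y ≠ 10 → (run I grow s2).var y = s2.var y := fun y h =>
      run_var (by simp [grow, vars, h])
    have ha : ∀ a, a ≠ 8 → a ≠ 9 → (run I grow s2).arr a = s2.arr a := fun y h h' =>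
      run_arr (by simp [grow, arrs, h, h'])
    refine ⟨?_, ?_⟩
    · rw [hv 5 (by decide), v2 5 (by decide) (by decide), v1 5 (by decide), h5]
    · unfold Memory.Searching
      rw [ha 4 (by decide) (by decide), ha 5 (by decide) (by decide),
        ha 6 (by decide) (by decide), ha 7 (by decide) (by decide), hv 3 (by decide), r3,
        a2 4 (by decide) (by decide), a2 7 (by decide) (by decide)]
      rw [e2, e7, e8, a2 7 (by decide) (by decide), a2 8 (by decide) (by decide)] at g2
      rw [e8, a2 9 (by decide) (by decide)] at g1
      exact tree.grow hk hbr b1 b2 hbq1 htight g1 g2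

theorem run_initSearch {k : ℕ} (h1 : s.var 1 = m) (h2 : s.var 2 = k) (hk : k < m)
    (hb : ∀ q < m, s.arr 1 q = q * m) (hs : s.Certified m k) :
    (initSearch.run I s).var 5 = 0 ∧ (initSearch.run I s).Searching m k 0 := by
  subst h2
  rw [initSearch, run_seq, run_seq, run_seq, run_seq]
  set s1 := run I (.store 6 (.var 2) (.var 3)) s with hs1
  obtain ⟨c1, -⟩ := run_rep_store (I := I) (s := s1) (x := 4) (b := 1) (N := m) (a := 9)
    (e₁ := .var 4) (e₂ := .lit 0) (fun q => q) (fun q => 0) (by simpa [hs1])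
    (fun _ _ _ _ h => h) (fun i hi t h4 _ _ _ => by simp [NExp.eval, h4])
  set s2 := run I (.rep 4 1 (.store 9 (.var 4) (.lit 0))) s1 with hs2
  have v2 : ∀ y, y ≠ 4 → s2.var y = s.var y := fun y hy => by
    rw [hs2, run_var (by simpa [vars] using hy)]
    rfl
  have a2 : ∀ b, b ≠ 9 → s2.arr b = s1.arr b := fun b hy => by
    rw [hs2, run_arr (by simpa [arrs] using hy)]
  have e2 := v2 2 (by decide)
  set s3 := run I (.store 9 (.var 2) (.lit 1)) s2 with hs3
  have a9 : ∀ r < m, s3.arr 9 r = if r = s.var 2 then 1 else 0 := fun r hr => by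
    simp [hs3, NExp.eval, Function.update_apply, e2, c1 r hr]
  have a3 : ∀ b, b ≠ 9 → s3.arr b = s1.arr b := fun b hy => by
    rw [← a2 b hy]
    simp [hs3, hy]
  have a31 : s3.arr 1 = s.arr 1 := a3 1 (by decide)
  have a37 : s3.arr 7 = s.arr 7 := a3 7 (by decide)
  have e32 : s3.var 2 = s.var 2 := e2
  obtain ⟨d1, -⟩ := run_rep_store (I := I) (s := s3) (x := 4) (b := 1) (N := m) (a := 8)
    (e₁ := .add (.get 1 (.var 2)) (.var 4)) (e₂ := .get 7 (.var 4))
    (fun q => s.var 2 * m + q) (fun q => s.arr 7 q) ((v2 1 (by decide)).trans h1)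
    (fun i hi j hj h => ((cell_eq_iff hi hj).1 h).2) (fun i hi t h4 hvar harr _ => by
      have t2 := (hvar 2 (by decide)).trans e32
      have t1 := (harr 1 (by decide)).trans a31
      have t7 := (harr 7 (by decide)).trans a37
      simp [NExp.eval, h4, t1, t2, t7, hb _ hk])
  set s4 := run I (.rep 4 1 (.store 8 (.add (.get 1 (.var 2)) (.var 4)) (.get 7 (.var 4)))) s3
    with hs4
  have a4 : ∀ b, b ≠ 8 → s4.arr b = s3.arr b := fun b hy => by
    rw [hs4, run_arr (by simpa [arrs] using hy)]
  have a4' : ∀ b, b ≠ 8 → b ≠ 9 → s4.arr b = s1.arr b := fun b h8 h9 => by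
    rw [a4 b h8, a3 b h9]
  have v4 : s4.var 3 = s.var 3 := by
    rw [hs4, run_var (by simp [vars])]
    exact v2 3 (by decide)
  refine ⟨by simp [NExp.eval], ?_⟩
  unfold Memory.Searching
  rw [run_assign, Memory.setVar_arr, Memory.setVar_var_of_ne _ _ (by decide), v4,
    a4' 4 (by decide) (by decide), a4' 5 (by decide) (by decide),
    a4' 6 (by decide) (by decide), a4' 7 (by decide) (by decide), a4 9 (by decide)]
  have a15 : ∀ b, b ≠ 6 → s1.arr b = s.arr b := fun b hb => by simp [hs1, hb]
  rw [a15 4 (by decide), a15 5 (by decide), a15 7 (by decide)]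
  refine DualCertificate.start hs hk (fun p _ => ?_) a9 d1
  simp [hs1, NExp.eval, Function.update_apply]

/-- Every round before the augmentation adds a reached row, and the later rounds do nothing. A
search still open after `m` rounds would have `m + 1` reached rows among `m`. -/
theorem run_search {k : ℕ} (h1 : s.var 1 = m) (h2 : s.var 2 = k) (hk : k < m)
    (hb : ∀ q < m, s.arr 1 q = q * m) (hs : s.Certified m k) :
    (search.run I s).Certified m (k + 1) := by
  rw [search, run_seq]
  obtain ⟨i1, i2⟩ := run_initSearch (I := I) h1 h2 hk hb hs
  set s1 := run I initSearch s with hs1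
  have e1 : s1.var 1 = m := (run_var (by decide)).trans h1
  have e2 : s1.var 2 = k := (run_var (by decide)).trans h2
  have a1 : s1.arr 1 = s.arr 1 := run_arr (by decide)
  have hset : ∀ (t : Memory) (i : ℕ), (t.var 5 = 0 ∧ t.Searching m k i ∨
      t.var 5 = 1 ∧ t.Certified m (k + 1)) → ∀ x, (t.setVar 6 x).var 5 = 0 ∧
        (t.setVar 6 x).Searching m k i ∨
      (t.setVar 6 x).var 5 = 1 ∧ (t.setVar 6 x).Certified m (k + 1) := fun t i h x => by
    simpa [Memory.Searching, Memory.Certified] using h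
  have := run_rep_induction (I := I) (s := s1) (x := 6) (N := m)
    (c := .ite (.eq (.var 5) (.lit 0)) searchStep)
    (fun i t => t.var 5 = 0 ∧ t.Searching m k i ∨ t.var 5 = 1 ∧ t.Certified m (k + 1)) e1
    (by decide) (hset s1 0 (.inl ⟨i1, i2⟩) 0) (by
    rintro i hi t - hvar harr hP
    refine hset _ _ ?_ _
    rcases hP with ⟨h5, hP⟩ | ⟨h5, hP⟩
    · rw [run_ite_of_true (by simpa [NExp.eval] using h5)]
      exact run_searchStep ((hvar 1 (by decide) (by decide)).trans e1)
        ((hvar 2 (by decide) (by decide)).trans e2) hk h5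
        (by rwa [harr 1 (by decide), a1]) hP
    · rw [run_ite_of_false (by simp [NExp.eval, h5])]
      exact .inr ⟨h5, hP⟩)
  rcases this with ⟨-, h⟩ | ⟨-, h⟩
  · exact absurd (SearchTree.lt_of_card h) (lt_irrefl m)
  · exact h

theorem run_main [NeZero n] : ∃ μ : Fin m ≃ Fin m,
    (∀ ν : Fin m ≃ Fin m, ∑ q, I.cost q (μ q) ≤ ∑ q, I.cost q (ν q)) ∧
      ∀ p : Fin m, (main.run I (initialMemory n m)).arr 0 p =
        ((positionTeam (μ.symm p) : Fin n) : ℕ) := by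
  rw [main, run_seq, run_seq, run_seq, run_seq]
  set s0 := initialMemory n m with hs0
  have t1 := fun q hq => run_initTables (I := I) (s := s0) (q := q) rfl rfl rfl rfl
    (Nat.pos_of_ne_zero (NeZero.ne n)) hq
  set s1 := run I initTables s0 with hs1
  have e10 : s1.var 0 = n := run_var (by decide)
  have e11 : s1.var 1 = m := run_var (by decide)
  have a15 : s1.arr 5 = fun _ => 0 := run_arr (by decide)
  have t2 := fun q hq => run_initScales (I := I) (s := s1) (q := q) e10 e11 hq
  set s2 := run I initScales s1 with hs2
  have e20 : s2.var 0 = n := (run_var (by decide)).trans e10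
  have e21 : s2.var 1 = m := (run_var (by decide)).trans e11
  have a2 : ∀ a, a ≠ 3 → s2.arr a = s1.arr a := fun a ha =>
    run_arr (by simp [initScales, initScalesStep, arrs, ha])
  have t3 := run_initCosts (I := I) (s := s2) e20 e21
    (fun q hq => by rw [a2 1 (by decide), (t1 q hq).1])
    (fun q hq => by rw [a2 2 (by decide), (t1 q hq).2.1]) t2
  set s3 := run I initCosts s2 with hs3
  have e31 : s3.var 1 = m := (run_var (by decide)).trans e21
  have a3 : ∀ a, a ≠ 3 → a ≠ 4 → s3.arr a = s1.arr a := fun a h3 h4 =>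
    (run_arr (by simp [initCosts, initCostsStep, addOrdinal, addRank, arrs, h4])).trans (a2 a h3)
  have a31 : ∀ q < m, s3.arr 1 q = q * m := fun q hq => by
    rw [a3 1 (by decide) (by decide), (t1 q hq).1]
  have hset : ∀ (t : Memory) (i x : ℕ), (t.setVar 2 x).Certified m i ↔ t.Certified m i :=
    fun t i x => by simp [Memory.Certified]
  have hcert : (run I (.rep 2 1 search) s3).Certified m m := by
    refine run_rep_induction (N := m) (c := search) (fun i t => t.Certified m i) e31 (by decide)
      ((hset _ _ _).2 ?_) ?_
    -- The empty matching is certified by zero row duals. Variable 3 still holds what an earlier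
    -- loop left there, which is harmless because any number bounds zero.
    · refine ⟨by simp, by simp, fun q _ hq => ?_, by simp, by simp, fun q hq => ?_,
        fun q _ hq => ?_⟩
      · rw [a3 7 (by decide) (by decide), (t1 q hq).2.2]
      · simp [a3 5 (by decide) (by decide), a15]
      · simp [a3 5 (by decide) (by decide), a15]
    · intro i hi t h2 hvar harr hP
      exact (hset _ _ _).2 (run_search ((hvar 1 (by decide) (by decide)).trans e31) h2 hi
        (by rwa [harr 1 (by decide)]) hP)
  set s4 := run I (.rep 2 1 search) s3 with hs4
  have e41 : s4.var 1 = m := (run_var (by decide)).trans e31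
  have a44 : s4.arr 4 = s3.arr 4 := run_arr (by decide)
  have a42 : ∀ q < m, s4.arr 2 q = q % n := fun q hq => by
    rw [hs4, run_arr (by decide), a3 2 (by decide) (by decide), (t1 q hq).2.1]
  obtain ⟨μ, hμ, hmin⟩ := DualCertificate.exists_equiv (I := I) hcert fun q p => by
    rw [a44, t3 q p]
  refine ⟨μ, hmin, fun p => ?_⟩
  -- Position `q` writes its team into the cell of the player matched to it; injectivity of the
  -- matching keeps these cells distinct.
  obtain ⟨h, -⟩ := run_rep_store (I := I) (s := s4) (x := 2) (b := 1) (N := m) (a := 0)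
    (e₁ := .get 7 (.var 2)) (e₂ := .get 2 (.var 2)) (fun q => s4.arr 7 q) (fun q => q % n) e41
    (fun i hi j hj h => hcert.inj i hi j hj h) (fun i hi t h2 hvar harr _ => by
      simp [NExp.eval, h2, harr 7 (by decide), harr 2 (by decide), a42 i hi])
  have := h (μ.symm p) (μ.symm p).2
  rw [← hμ, Equiv.apply_symm_apply] at this
  exact this

/-- The program outputs an output of the algorithm in polynomial time. -/
theorem computes_main [NeZero n] (I : FairInstance n m) :
    ∃ (A : Allocation n m) (t : ℕ), Computes main.toCmd I A t ∧ t ≤ main.time.eval (n + m) ∧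
      IsAlgorithmOutput I A := by
  obtain ⟨μ, hμ, hout⟩ := run_main (I := I)
  obtain ⟨t, ht, he⟩ := exec_toCmd (I := I) main_wellFormed (s := initialMemory n m) (N := n + m)
    (by
      intro b hb
      interval_cases b <;> simp [initialMemory])
  exact ⟨_, t, ⟨_, he, hout⟩, ht, isAlgorithmOutput_of_cost_le hμ⟩

end Prog

end TwoSidedDivision

open TwoSidedDivision
theorem theorem1 :
    (∀ (n m : ℕ) [NeZero n] (I : FairInstance n m),
      (∃ A : Allocation n m, A.Balanced ∧ I.EF11 A ∧ I.SwapStable A) ∧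
      (I.NonnegativeValue ∨ I.NonpositiveValue →
        ∃ A : Allocation n m, A.Balanced ∧ I.EF1 A ∧ I.SwapStable A) ∧
      (∃ A : Allocation n m, IsAlgorithmOutput I A) ∧
      (∀ A : Allocation n m, IsAlgorithmOutput I A →
        A.Balanced ∧ I.EF11 A ∧ I.SwapStable A ∧
          (I.NonnegativeValue ∨ I.NonpositiveValue → I.EF1 A))) ∧
    (∃ (c : Cmd) (B : Polynomial ℕ),
      ∀ (n m : ℕ) [NeZero n] (I : FairInstance n m),
        ∃ (A : Allocation n m) (t : ℕ),
          Computes c I A t ∧ t ≤ B.eval (n + m) ∧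
          IsAlgorithmOutput I A ∧ A.Balanced ∧ I.EF11 A ∧ I.SwapStable A ∧
          (I.NonnegativeValue ∨ I.NonpositiveValue → I.EF1 A)) := by
  refine ⟨fun n m _ I => ?_, Prog.main.toCmd, Prog.main.time, fun n m _ I => ?_⟩
  · obtain ⟨A, hA⟩ := exists_isAlgorithmOutput I
    obtain ⟨h1, h2, h3, h4⟩ := hA.properties
    exact ⟨⟨A, h1, h2, h3⟩, fun hs => ⟨A, h1, h4 hs, h3⟩, ⟨A, hA⟩, fun _ h => h.properties⟩
  · obtain ⟨A, t, hc, ht, hA⟩ := Prog.computes_main I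
    exact ⟨A, t, hc, ht, hA, hA.properties⟩
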